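/- Let $G$ be a second-countable unimodular locally compact (Hausdorff) group with Haar measure $\mu_G$, and fix a compact symmetric neighborhood $Q$ of the identity. A *Følner sequence* is a sequence $(K_n)_{n\in\mathbb N}$ of compact sets with $\mu_G(K_n)>0$ such that $\mu_G(K_nK\,\Delta\,K_n)/\mu_G(K_n)\to 0$ for every non-empty compact $K\subseteq G$; it is a *strong Følner sequence* if moreover $\mu_G(K_nK\cap K_n^cK)/\mu_G(K_n)\to 0$ for every compact $K\subseteq G$. Assume that $G$ is amenable, i.e. that it admits a Følner sequence. For $\Lambda\subseteq G$ the *lower Beurling density* is $$D^-(\Lambda)=\lim_{n\to\infty}\inf_{x\in G}\frac{\#(\Lambda\cap xK_n)}{\mu_G(K_n)},$$ where $(K_n)$ is any strong Følner sequence (the limit exists and does not depend on the sequence). Let $(\pi,\mathcal H_\pi)$ be a projective unitary representation of $G$ on a complex Hilbert space, i.e. a strongly measurable map $\pi$ from $G$ to the unitary operators of $\mathcal H_\pi$ with $\pi(xy)=\sigma(x,y)\pi(x)\pi(y)$ for some $\sigma:G\times G\to\mathbb T$. Write $V_gf(x)=\langle f,\pi(x)g\rangle$. Assume that $\pi$ is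 irreducible (no closed invariant subspaces other than $\{0\}$ and $\mathcal H_\pi$) and integrable (there is $g_0\neq 0$ with $V_{g_0}g_0\in L^1(G)$), and let $d_\pi>0$ be its formal degree, i.e. the number with $$\int_G\langle f_1,\pi(x)g_1\rangle\langle\pi(x)g_2,f_2\rangle\,d\mu_G(x)=d_\pi^{-1}\langle f_1,f_2\rangle\overline{\langle g_1,g_2\rangle}\qquad\text{for all } f_1,f_2,g_1,g_2\in\mathcal H_\pi .$$ Let $\mathcal B^1_\pi$ be the set of all $g\in\mathcal H_\pi$ such that $V_gg\in W^L(L^1)$, i.e. such that $V_gg\in L^\infty_{\mathrm{loc}}(G)$ and the local maximal function $x\mapsto\operatorname{ess\,sup}_{z\in Q}|V_gg(xz)|$ belongs to $L^1(G)$. A family $(v_i)_{i\in I}$ in $\mathcal H_\pi$ is a *frame* if there are $A,B>0$ with $A\|f\|^2\le\sum_{i\in I}|\langle f,v_i\rangle|^2\le B\|f\|^2$ for all $f\in\mathcal H_\pi$. **Theorem.** Let $\Lambda\subseteq G$ be discrete and let $g\in\mathcal B^1_\pi$. If $(\pi(\lambda)g)_{\lambda\in\Lambda}$ is a frame for $\mathcal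 H_\pi$ and $D^-(\Lambda)>d_\pi$, then there exists $\Gamma\subseteq\Lambda$ with $D^-(\Gamma)>0$ such that $(\pi(\lambda)g)_{\lambda\in\Lambda\setminus\Gamma}$ is a frame for $\mathcal H_\pi$. -/

import Mathlib

open MeasureTheory Filter Topology
open scoped ENNReal Pointwise

noncomputable section

/-! ### Følner sequences and lower Beurling density -/

/-- A (right) Følner sequence: non-null compact sets `K n` with
`μ (K n * C ∆ K n) / μ (K n) → 0` for every (non-empty) compact set `C`. -/
structure IsFolnerSeq {G : Type*} [Group G] [TopologicalSpace G] [MeasurableSpace G]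
    (μ : Measure G) (K : ℕ → Set G) : Prop where
  isCompact : ∀ n, IsCompact (K n)
  measure_ne_zero : ∀ n, μ (K n) ≠ 0
  tendsto_symmDiff : ∀ C : Set G, IsCompact C → C.Nonempty →
    Tendsto (fun n => μ (symmDiff (K n * C) (K n)) / μ (K n)) atTop (𝓝 0)

/-- A (right) strong Følner sequence: a Følner sequence with, in addition,
`μ (K n * C ∩ (K n)ᶜ * C) / μ (K n) → 0` for every compact set `C`. -/
structure IsStrongFolnerSeq {G : Type*} [Group G] [TopologicalSpace G] [MeasurableSpace G]
    (μ : Measure G) (K : ℕ → Set G) : Prop extends IsFolnerSeq μ K where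
  tendsto_boundary : ∀ C : Set G, IsCompact C →
    Tendsto (fun n => μ ((K n * C) ∩ ((K n)ᶜ * C)) / μ (K n)) atTop (𝓝 0)

/-- Amenability (of a second-countable locally compact group with Haar measure `μ`):
existence of a Følner sequence. -/
def IsAmenableGroup {G : Type*} [Group G] [TopologicalSpace G] [MeasurableSpace G]
    (μ : Measure G) : Prop :=
  ∃ K : ℕ → Set G, IsFolnerSeq μ K

/-- `inf_{x ∈ G} #(Λ ∩ x K) / μ(K)`. -/
def minRelativeCount {G : Type*} [Group G] [MeasurableSpace G]
    (μ : Measure G) (Λ K : Set G) : ℝ≥0∞ :=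
  ⨅ x : G, ((Λ ∩ x • K).encard : ℝ≥0∞) / μ K

/-- The lower Beurling density of `Λ` computed along the sequence `K`. It is written as a lower
limit so that it is meaningful without knowing that the limit exists. -/
def lowerBeurlingDensity {G : Type*} [Group G] [MeasurableSpace G]
    (μ : Measure G) (K : ℕ → Set G) (Λ : Set G) : ℝ≥0∞ :=
  liminf (fun n => minRelativeCount μ Λ (K n)) atTop

/-- `D` is the lower Beurling density of `Λ`: along every strong Følner sequence `K`, the limit of
`inf_{x ∈ G} #(Λ ∩ x K_n) / μ(K_n)` exists and equals `D`. -/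
def HasLowerBeurlingDensity {G : Type*} [Group G] [TopologicalSpace G] [MeasurableSpace G]
    (μ : Measure G) (Λ : Set G) (D : ℝ≥0∞) : Prop :=
  ∀ K : ℕ → Set G, IsStrongFolnerSeq μ K →
    Tendsto (fun n => minRelativeCount μ Λ (K n)) atTop (𝓝 D)

/-! ### The Wiener amalgam space `W^L(L¹)` -/

/-- The left-sided local maximal function `M^L F (x) = ess sup_{z ∈ Q} |F (x z)|`. -/
def localMaximal {G : Type*} [Group G] [MeasurableSpace G]
    (μ : Measure G) (Q : Set G) (F : G → ℂ) (x : G) : ℝ≥0∞ :=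
  essSup (fun z => ‖F (x * z)‖ₑ) (μ.restrict Q)

/-- `F ∈ W^L(L¹)`: `F` is locally essentially bounded and `M^L F` is integrable. -/
structure MemWienerL1 {G : Type*} [Group G] [TopologicalSpace G] [MeasurableSpace G]
    (μ : Measure G) (Q : Set G) (F : G → ℂ) : Prop where
  locallyBounded : ∀ C : Set G, IsCompact C → MemLp F ∞ (μ.restrict C)
  aemeasurable : AEMeasurable (localMaximal μ Q F) μ
  lintegral_lt_top : ∫⁻ x, localMaximal μ Q F x ∂μ < ∞

/-! ### Projective unitary representations -/

/-- A projective unitary representation: a strongly measurable map `π` into the unitary operators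
with `π (x y) = σ (x, y) π x π y` for a function `σ` with values in the unit circle. -/
structure ProjUnitaryRep (G : Type*) [Group G] [MeasurableSpace G]
    (H : Type*) [NormedAddCommGroup H] [InnerProductSpace ℂ H] where
  toFun : G → (H ≃ₗᵢ[ℂ] H)
  exists_cocycle : ∃ σ : G → G → Circle, ∀ x y : G, ∀ f : H,
    toFun (x * y) f = (σ x y : ℂ) • toFun x (toFun y f)
  stronglyMeasurable : ∀ f : H, StronglyMeasurable fun x => toFun x f

namespace ProjUnitaryRep

variable {G : Type*} [Group G] [MeasurableSpace G]
  {H : Type*} [NormedAddCommGroup H] [InnerProductSpace ℂ H]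

instance : CoeFun (ProjUnitaryRep G H) (fun _ => G → (H ≃ₗᵢ[ℂ] H)) := ⟨toFun⟩

/-- The matrix coefficient `V_g f (x) = ⟨f, π x g⟩`, where `⟨·, ·⟩` is linear in the first entry
(Mathlib's `inner` is linear in the second one). -/
def coeff (π : ProjUnitaryRep G H) (g f : H) (x : G) : ℂ :=
  inner ℂ (π x g) f

/-- Irreducibility: the only closed invariant subspaces are `0` and the whole space. -/
def IsIrreducible (π : ProjUnitaryRep G H) : Prop :=
  ∀ V : Submodule ℂ H, IsClosed (V : Set H) → (∀ x : G, ∀ f ∈ V, π x f ∈ V) → V = ⊥ ∨ V = ⊤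

/-- An integrable representation: irreducible, with a non-zero integrable vector. -/
structure IsIntegrableRep (π : ProjUnitaryRep G H) (μ : Measure G) : Prop where
  irreducible : π.IsIrreducible
  exists_integrable_vector : ∃ g : H, g ≠ 0 ∧ Integrable (π.coeff g g) μ

/-- `d > 0` satisfies the orthogonality relations
`∫ ⟨f₁, π x g₁⟩ ⟨π x g₂, f₂⟩ dμ(x) = d⁻¹ ⟨f₁, f₂⟩ conj ⟨g₁, g₂⟩`. -/
def IsFormalDegree (π : ProjUnitaryRep G H) (μ : Measure G) (d : ℝ) : Prop :=
  0 < d ∧ ∀ f₁ f₂ g₁ g₂ : H,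
    Integrable (fun x => inner ℂ (π x g₁) f₁ * inner ℂ f₂ (π x g₂)) μ ∧
    ∫ x, inner ℂ (π x g₁) f₁ * inner ℂ f₂ (π x g₂) ∂μ
      = (d : ℂ)⁻¹ * inner ℂ f₂ f₁ * starRingEnd ℂ (inner ℂ g₂ g₁)

/-- The formal degree `d_π`: the number satisfying the orthogonality relations. Such a number
exists, and is unique, for every irreducible square-integrable representation of a unimodular
group; that is not built into the definition. -/
def formalDegree (π : ProjUnitaryRep G H) (μ : Measure G) : ℝ :=
  Classical.epsilon fun d : ℝ => π.IsFormalDegree μ d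

/-- The space `B¹_π` of all `g` with `V_g g ∈ W^L(L¹)`, where `W^L(L¹)` is built with the unit
neighbourhood `Q`. -/
def B1 [TopologicalSpace G] (π : ProjUnitaryRep G H) (μ : Measure G) (Q : Set G) : Set H :=
  {g | MemWienerL1 μ Q (π.coeff g g)}

end ProjUnitaryRep

/-- `(v i)` is a frame: `A ‖f‖² ≤ ∑ |⟨f, v i⟩|² ≤ B ‖f‖²` for all `f`, with `A, B > 0`. -/
def IsHilbertFrame {ι : Type*} {H : Type*} [NormedAddCommGroup H] [InnerProductSpace ℂ H]
    (v : ι → H) : Prop :=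
  ∃ A B : ℝ, 0 < A ∧ 0 < B ∧ ∀ f : H,
    Summable (fun i => ‖inner ℂ (v i) f‖ ^ 2) ∧
    A * ‖f‖ ^ 2 ≤ ∑' i, ‖inner ℂ (v i) f‖ ^ 2 ∧
    ∑' i, ‖inner ℂ (v i) f‖ ^ 2 ≤ B * ‖f‖ ^ 2

end

open scoped NNReal

/-!
The frame `(π l g)` with frame operator `S` is relatively separated, and since `V_g g ∈ W^L(L¹)` its
Gram matrix is localized near the diagonal. Localized operators form a vector space that is stable
under right multiplication by `S`, so truncating the Neumann series of `S⁻¹` gives a self-adjoint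
localized `R` with `R S ≈ 1`.

Integrating `∑ ⟨π y g, R (π l g)⟩ ⟨π l g, π y g⟩ = ⟨π y g, R S π y g⟩` against the orthogonality
relations shows that in a large Følner translate the diagonal entries `⟨π l g, R (π l g)⟩` have
average at most about `d_π / D⁻(Λ) < 1`. Hence the indices with diagonal entry at most some `α < 1`
are relatively dense, and a maximal separated set `Γ` of such indices is still relatively dense, so
it has positive density. On `Γ` the matrix `⟨π i g, R (π j g)⟩` is nearly diagonal with diagonal
entries at most `α`, so in `⟨π i g, f⟩ ≈ ∑ j, ⟨π i g, R (π j g)⟩ ⟨π j g, f⟩` the coefficients on `Γ`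
can be absorbed and are controlled by those on `Λ \ Γ`.
-/

/-! ### Counting in relatively separated sets -/

section Counting

variable {G : Type*} [Group G]

/-- `Λ` is relatively separated, with at most `N` points in each left translate of `Q`. -/
def IsRelativelySeparated (Q : Set G) (N : ℕ) (Λ : Set G) : Prop :=
  ∀ x : G, (Λ ∩ x • Q).encard ≤ N

/-- `Γ` is relatively dense: it meets every left translate of some compact set. -/
def IsRelativelyDense [TopologicalSpace G] (Γ : Set G) : Prop :=
  ∃ L : Set G, IsCompact L ∧ ∀ x : G, (Γ ∩ x • L).Nonempty

theorem mem_smul_set_comm {x y : G} {s : Set G} : x ∈ y • s ↔ y ∈ x • s⁻¹ := by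
  simp [Set.mem_smul_set_iff_inv_smul_mem]

theorem encard_inter_eq_tsum_indicator {α : Type*} (Λ s : Set α) :
    ((Λ ∩ s).encard : ℝ≥0∞) = ∑' l : Λ, s.indicator 1 (l : α) := by
  rw [← ENNReal.tsum_set_one, tsum_subtype (Λ ∩ s) (fun _ => (1 : ℝ≥0∞)), tsum_subtype Λ,
    Set.indicator_indicator]
  rfl

theorem encard_inter_union_le {α : Type*} (Λ s t : Set α) :
    ((Λ ∩ (s ∪ t)).encard : ℝ≥0∞) ≤ (Λ ∩ s).encard + (Λ ∩ t).encard := by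
  rw [Set.inter_union_distrib_left]
  exact_mod_cast Set.encard_union_le _ _

variable {Q Λ Γ : Set G} {N : ℕ}

theorem IsRelativelySeparated.mono (hΛ : IsRelativelySeparated Q N Λ) (h : Γ ⊆ Λ) :
    IsRelativelySeparated Q N Γ := fun x =>
  (Set.encard_le_encard (Set.inter_subset_inter_left _ h)).trans (hΛ x)

variable [TopologicalSpace G] [IsTopologicalGroup G]

theorem IsRelativelySeparated.countable [SecondCountableTopology G]
    (hΛ : IsRelativelySeparated Q N Λ) (hQ1 : Q ∈ 𝓝 (1 : G)) : Λ.Countable := by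
  obtain ⟨t, ht, hcov⟩ := TopologicalSpace.countable_cover_nhds (f := fun x : G => x • Q)
    (fun x => by simpa using smul_mem_nhds_smul x hQ1)
  have hsub : Λ ⊆ ⋃ x ∈ t, Λ ∩ x • Q := by
    rw [← Set.inter_iUnion₂, hcov, Set.inter_univ]
  refine (ht.biUnion fun x _ => Set.Finite.countable ?_).mono hsub
  exact Set.encard_lt_top_iff.1 ((hΛ x).trans_lt (ENat.natCast_lt_top N))

variable [MeasurableSpace G] [BorelSpace G] (μ : Measure G)

/-- By uniqueness of Haar measure `μ.inv = c • μ`, and a symmetric set shows `c = 1`. -/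
theorem isInvInvariant_of_isMulRightInvariant [LocallyCompactSpace G] [SecondCountableTopology G]
    [μ.IsHaarMeasure] [μ.IsMulRightInvariant] : μ.IsInvInvariant := by
  obtain ⟨L, hL, hL1⟩ := exists_compact_mem_nhds (1 : G)
  set U : Set G := L ∪ L⁻¹
  have hUc : IsCompact U := hL.union hL.inv
  have hU0 : μ U ≠ 0 :=
    (Measure.measure_pos_of_mem_nhds μ (mem_of_superset hL1 Set.subset_union_left)).ne'
  have hinv := Measure.isMulLeftInvariant_eq_smul μ.inv μ
  have hU : μ U = Measure.haarScalarFactor μ.inv μ * μ U := by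
    have h : μ.inv U = μ U := by rw [Measure.inv_apply]; simp [U, Set.union_comm]
    conv_lhs => rw [← h, hinv]
    rfl
  have hc : (Measure.haarScalarFactor μ.inv μ : ℝ≥0∞) = 1 :=
    ((ENNReal.mul_eq_right hU0 hUc.measure_lt_top.ne).1 hU.symm)
  refine ⟨?_⟩
  rw [hinv, ENNReal.coe_eq_one.1 hc, one_smul]

section Integration

variable {μ}

/-- A point `w` lies in `(y⁻¹ * l) • V` for at most `N` indices `l`, namely some of those
in `(y * w) • Q`. -/
theorem IsRelativelySeparated.tsum_setLIntegral_smul_le [SecondCountableTopology G]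
    (hΛ : IsRelativelySeparated Q N Λ) (hQs : Q⁻¹ = Q) (hQ1 : Q ∈ 𝓝 (1 : G))
    {V : Set G} (hVQ : V ⊆ Q) (hV : MeasurableSet V)
    {F : G → ℝ≥0∞} (hF : AEMeasurable F μ) (y : G) :
    ∑' l : Λ, ∫⁻ w in (y⁻¹ * (l : G)) • V, F w ∂μ ≤ N * ∫⁻ w, F w ∂μ := by
  have : Countable Λ := (hΛ.countable hQ1).to_subtype
  have hms : ∀ z : G, MeasurableSet (z • V) := fun z => hV.const_smul z
  simp_rw [← lintegral_indicator (hms _)]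
  rw [← lintegral_tsum (fun l => hF.indicator (hms _)),
    ← lintegral_const_mul' _ _ (ENNReal.natCast_ne_top N)]
  refine lintegral_mono fun w => ?_
  have hmem : ∀ l : G, w ∈ (y⁻¹ * l) • V → l ∈ (y * w) • Q := fun l hl => by
    rw [mem_smul_set_comm, hQs]
    simpa [Set.mem_smul_set_iff_inv_smul_mem, mul_assoc] using Set.smul_set_mono hVQ hl
  calc ∑' l : Λ, ((y⁻¹ * (l : G)) • V).indicator F w
      ≤ ∑' l : Λ, ((y * w) • Q).indicator 1 (l : G) * F w := by
        refine ENNReal.tsum_le_tsum fun l => ?_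
        by_cases h : w ∈ (y⁻¹ * (l : G)) • V
        · simp [h, hmem l h]
        · simp [h]
    _ = ((Λ ∩ (y * w) • Q).encard : ℝ≥0∞) * F w := by
        rw [ENNReal.tsum_mul_right, encard_inter_eq_tsum_indicator]
    _ ≤ N * F w := by gcongr; exact_mod_cast hΛ _

theorem IsRelativelySeparated.encard_inter_mul_measure_le [SecondCountableTopology G]
    [μ.IsMulLeftInvariant] (hΛ : IsRelativelySeparated Q N Λ) (hQs : Q⁻¹ = Q)
    (hQ1 : Q ∈ 𝓝 (1 : G)) (hQm : MeasurableSet Q) (E : Set G) :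
    (Λ ∩ E).encard * μ Q ≤ N * μ (E * Q) := by
  set M := toMeasurable μ (E * Q)
  have hM : MeasurableSet M := measurableSet_toMeasurable _ _
  have hterm : ∀ l : G, E.indicator 1 l * μ Q ≤ ∫⁻ w in l • Q, M.indicator 1 w ∂μ := by
    intro l
    by_cases h : l ∈ E
    · have hsub : l • Q ⊆ M :=
        (Set.smul_set_subset_mul h).trans (subset_toMeasurable μ (E * Q))
      rw [lintegral_indicator_one hM, Measure.restrict_apply hM,
        Set.inter_eq_self_of_subset_right hsub, measure_smul]
      simp [h]
    · simp [h]
  calc (Λ ∩ E).encard * μ Q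
      = ∑' l : Λ, E.indicator 1 (l : G) * μ Q := by
        rw [encard_inter_eq_tsum_indicator, ENNReal.tsum_mul_right]
    _ ≤ ∑' l : Λ, ∫⁻ w in ((1 : G)⁻¹ * (l : G)) • Q, M.indicator 1 w ∂μ := by
        simpa using ENNReal.tsum_le_tsum fun l : Λ => hterm l
    _ ≤ N * ∫⁻ w, M.indicator 1 w ∂μ :=
        hΛ.tsum_setLIntegral_smul_le hQs hQ1 subset_rfl hQm
          (measurable_one.indicator hM).aemeasurable 1
    _ = N * μ (E * Q) := by rw [lintegral_indicator_one hM, measure_toMeasurable]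

theorem setLIntegral_encard_inter_smul_le [μ.IsMulLeftInvariant] [μ.IsInvInvariant]
    (hΛ : Λ.Countable) {C : Set G} (hC : MeasurableSet C) (E : Set G) :
    ∫⁻ y in E, (Λ ∩ y • C).encard ∂μ ≤ (Λ ∩ (E * C)).encard * μ C := by
  have : Countable Λ := hΛ.to_subtype
  have hm : ∀ l : G, MeasurableSet (l • C⁻¹) := fun l => hC.inv.const_smul l
  have hcount : ∀ y, ((Λ ∩ y • C).encard : ℝ≥0∞) = ∑' l : Λ, ((l : G) • C⁻¹).indicator 1 y :=
    fun y => (encard_inter_eq_tsum_indicator _ _).trans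
      (tsum_congr fun l => Set.indicator_eq_indicator mem_smul_set_comm rfl)
  simp_rw [hcount]
  rw [lintegral_tsum fun l => (measurable_one.indicator (hm _)).aemeasurable,
    encard_inter_eq_tsum_indicator, ← ENNReal.tsum_mul_right]
  refine ENNReal.tsum_le_tsum fun l => ?_
  rw [lintegral_indicator_one (hm _), Measure.restrict_apply (hm _)]
  by_cases h : (l : G) ∈ E * C
  · rw [Set.indicator_of_mem h, Pi.one_apply, one_mul]
    exact (measure_mono Set.inter_subset_left).trans (by rw [measure_smul, Measure.measure_inv])
  · have hempty : (l : G) • C⁻¹ ∩ E = ∅ := by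
      refine Set.eq_empty_of_forall_notMem fun y ⟨hy, hyE⟩ => h ?_
      exact Set.smul_set_subset_mul hyE (mem_smul_set_comm.2 hy)
    simp [hempty]

/-- Average `#(Λ ∩ y • C) ≥ minRelativeCount μ Λ C * μ C` over `y ∈ E`. -/
theorem minRelativeCount_mul_measure_le_encard [T2Space G] [IsFiniteMeasureOnCompacts μ]
    [μ.IsMulLeftInvariant] [μ.IsInvInvariant] (hΛ : Λ.Countable) {C : Set G}
    (hC : IsCompact C) (hC0 : μ C ≠ 0) (E : Set G) :
    minRelativeCount μ Λ C * μ E ≤ (Λ ∩ (E * C)).encard := by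
  have hCt : μ C ≠ ∞ := hC.measure_lt_top.ne
  refine (ENNReal.mul_le_mul_iff_left hC0 hCt).1 ?_
  calc minRelativeCount μ Λ C * μ E * μ C
      = ∫⁻ _ in E, minRelativeCount μ Λ C * μ C ∂μ := by rw [setLIntegral_const]; ring
    _ ≤ ∫⁻ y in E, (Λ ∩ y • C).encard ∂μ := lintegral_mono fun y => by
        rw [← ENNReal.le_div_iff_mul_le (.inl hC0) (.inl hCt)]
        exact iInf_le _ y
    _ ≤ (Λ ∩ (E * C)).encard * μ C :=
        setLIntegral_encard_inter_smul_le hΛ hC.isClosed.measurableSet E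

end Integration

section Density

variable [T2Space G] [SecondCountableTopology G] {μ} [μ.IsHaarMeasure]

theorem IsRelativelySeparated.eventually_encard_inter_smul_le (hΛ : IsRelativelySeparated Q N Λ)
    (hQc : IsCompact Q) (hQs : Q⁻¹ = Q) (hQ1 : Q ∈ 𝓝 (1 : G))
    {K : ℕ → Set G} (hK : IsFolnerSeq μ K) :
    ∀ᶠ n in atTop, ∀ x : G, ((Λ ∩ x • K n).encard : ℝ≥0∞) ≤ N * 2 / μ Q * μ (K n) := by
  have hQ0 : μ Q ≠ 0 := (Measure.measure_pos_of_mem_nhds μ hQ1).ne'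
  have hQt : μ Q ≠ ∞ := hQc.measure_lt_top.ne
  have hQn : Q.Nonempty := ⟨1, mem_of_mem_nhds hQ1⟩
  filter_upwards [(hK.tendsto_symmDiff Q hQc hQn).eventually_le_const zero_lt_one] with n hn x
  rw [ENNReal.div_le_iff (hK.measure_ne_zero n) (hK.isCompact n).measure_lt_top.ne, one_mul] at hn
  have hKQ : μ (K n * Q) ≤ 2 * μ (K n) := by
    calc μ (K n * Q) ≤ μ (symmDiff (K n * Q) (K n) ∪ K n) :=
          measure_mono fun z hz => (em (z ∈ K n)).elim .inr fun h => .inl (.inl ⟨hz, h⟩)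
      _ ≤ μ (K n) + μ (K n) := (measure_union_le _ _).trans (by gcongr)
      _ = 2 * μ (K n) := (two_mul _).symm
  rw [← ENNReal.mul_div_right_comm, ENNReal.le_div_iff_mul_le (.inl hQ0) (.inl hQt)]
  calc (Λ ∩ x • K n).encard * μ Q ≤ N * μ (x • K n * Q) :=
        hΛ.encard_inter_mul_measure_le hQs hQ1 hQc.isClosed.measurableSet _
    _ ≤ N * (2 * μ (K n)) := by rw [smul_mul_assoc, measure_smul]; gcongr
    _ = N * 2 * μ (K n) := (mul_assoc _ _ _).symm

theorem IsRelativelySeparated.minRelativeCount_le_add (hΛ : IsRelativelySeparated Q N Λ)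
    (hQc : IsCompact Q) (hQs : Q⁻¹ = Q) (hQ1 : Q ∈ 𝓝 (1 : G)) [μ.IsInvInvariant]
    {C F : Set G} (hC : IsCompact C) (hC0 : μ C ≠ 0) (hF : IsCompact F) (hF0 : μ F ≠ 0) :
    minRelativeCount μ Λ C ≤ minRelativeCount μ Λ F
      + N / μ Q * (μ ((F * (C * Q ∪ Q)) ∩ (Fᶜ * (C * Q ∪ Q))) / μ F) := by
  have hQ0 : μ Q ≠ 0 := (Measure.measure_pos_of_mem_nhds μ hQ1).ne'
  have hQt : μ Q ≠ ∞ := hQc.measure_lt_top.ne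
  have hFt : μ F ≠ ∞ := hF.measure_lt_top.ne
  set B : Set G := (F * (C * Q ∪ Q)) ∩ (Fᶜ * (C * Q ∪ Q))
  conv_rhs => rw [minRelativeCount, ENNReal.iInf_add]
  refine le_iInf fun x => ?_
  have hboundary : ((F * C) \ F) * Q ⊆ B := by
    refine Set.subset_inter ?_ (Set.mul_subset_mul (fun z hz => hz.2) Set.subset_union_right)
    calc ((F * C) \ F) * Q ⊆ F * C * Q := Set.mul_subset_mul_right Set.sdiff_subset
      _ = F * (C * Q) := mul_assoc _ _ _
      _ ⊆ F * (C * Q ∪ Q) := Set.mul_subset_mul_left Set.subset_union_left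
  have hsub : x • F * C ⊆ x • F ∪ x • ((F * C) \ F) := by
    rw [smul_mul_assoc, ← Set.smul_set_union, Set.union_sdiff_self]
    exact Set.smul_set_mono Set.subset_union_right
  have hcount : ((Λ ∩ x • ((F * C) \ F)).encard : ℝ≥0∞) ≤ N / μ Q * μ B := by
    rw [← ENNReal.mul_div_right_comm, ENNReal.le_div_iff_mul_le (.inl hQ0) (.inl hQt)]
    refine (hΛ.encard_inter_mul_measure_le hQs hQ1 hQc.isClosed.measurableSet _).trans ?_
    rw [smul_mul_assoc, measure_smul]
    gcongr
  rw [← mul_div_assoc, ← ENNReal.add_div, ENNReal.le_div_iff_mul_le (.inl hF0) (.inl hFt)]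
  calc minRelativeCount μ Λ C * μ F
      = minRelativeCount μ Λ C * μ (x • F) := by rw [measure_smul]
    _ ≤ (Λ ∩ (x • F * C)).encard :=
        minRelativeCount_mul_measure_le_encard (hΛ.countable hQ1) hC hC0 _
    _ ≤ (Λ ∩ (x • F ∪ x • ((F * C) \ F))).encard := by gcongr
    _ ≤ (Λ ∩ x • F).encard + (Λ ∩ x • ((F * C) \ F)).encard := encard_inter_union_le _ _ _
    _ ≤ (Λ ∩ x • F).encard + N / μ Q * μ B := by gcongr

theorem IsRelativelySeparated.hasLowerBeurlingDensity (hΛ : IsRelativelySeparated Q N Λ)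
    (hQc : IsCompact Q) (hQs : Q⁻¹ = Q) (hQ1 : Q ∈ 𝓝 (1 : G)) [μ.IsInvInvariant] :
    HasLowerBeurlingDensity μ Λ
      (⨆ (C : Set G) (_ : IsCompact C) (_ : μ C ≠ 0), minRelativeCount μ Λ C) := by
  intro F hF
  refine tendsto_of_le_liminf_of_limsup_le (iSup₂_le fun C hC => iSup_le fun hC0 => ?_) ?_
  · have hQ0 : μ Q ≠ 0 := (Measure.measure_pos_of_mem_nhds μ hQ1).ne'
    have hboundary := ENNReal.Tendsto.const_mul (a := N / μ Q)
      (hF.tendsto_boundary _ ((hC.mul hQc).union hQc))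
      (.inr (ENNReal.div_ne_top (ENNReal.natCast_ne_top N) hQ0))
    rw [mul_zero] at hboundary
    rw [← ENNReal.liminf_add_of_right_tendsto_zero hboundary]
    exact le_liminf_of_le (by isBoundedDefault) (.of_forall fun n =>
      hΛ.minRelativeCount_le_add hQc hQs hQ1 hC hC0 (hF.isCompact n) (hF.measure_ne_zero n))
  · exact limsup_le_of_le (by isBoundedDefault) (.of_forall fun n =>
      le_iSup₂_of_le (F n) (hF.isCompact n) (le_iSup_of_le (hF.measure_ne_zero n) le_rfl))

theorem IsRelativelyDense.exists_pos_hasLowerBeurlingDensity (hΓd : IsRelativelyDense Γ)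
    (hΓ : IsRelativelySeparated Q N Γ) (hQc : IsCompact Q) (hQs : Q⁻¹ = Q)
    (hQ1 : Q ∈ 𝓝 (1 : G)) [μ.IsInvInvariant] :
    ∃ D : ℝ≥0∞, 0 < D ∧ HasLowerBeurlingDensity μ Γ D := by
  obtain ⟨L, hL, hmeet⟩ := hΓd
  refine ⟨_, ?_, hΓ.hasLowerBeurlingDensity hQc hQs hQ1⟩
  have hLQ : IsCompact (L ∪ Q) := hL.union hQc
  have hLQ0 : μ (L ∪ Q) ≠ 0 :=
    (Measure.measure_pos_of_mem_nhds μ (mem_of_superset hQ1 Set.subset_union_right)).ne'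
  refine lt_of_lt_of_le (b := 1 / μ (L ∪ Q)) (by simpa using hLQ.measure_lt_top.ne)
    (le_iSup₂_of_le (L ∪ Q) hLQ (le_iSup_of_le hLQ0 (le_iInf fun x => ?_)))
  gcongr
  have hne : (Γ ∩ x • (L ∪ Q)).Nonempty := (hmeet x).mono (by gcongr; exact Set.subset_union_left)
  exact_mod_cast Set.one_le_encard_iff_nonempty.2 hne

end Density

end Counting

/-! ### Schur's lemma and the orthogonality relations -/

theorem sesquilinForm_eq_zero_of_isAlt {E : Type*} [AddCommGroup E] [Module ℂ E]
    {B : E →ₗ⋆[ℂ] E →ₗ[ℂ] ℂ}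
    (hB : B.IsAlt) : B = 0 := by
  ext x y
  have h1 := hB.neg x y
  have h2 := hB.neg (Complex.I • x) y
  simp only [LinearMap.map_smulₛₗ, LinearMap.smul_apply, Complex.conj_I, smul_eq_mul,
    RingHom.id_apply] at h2
  rw [← h1] at h2
  simpa [self_eq_neg] using h2

namespace ProjUnitaryRep

section Algebra

variable {G : Type*} [Group G] [MeasurableSpace G]
  {H : Type*} [NormedAddCommGroup H] [InnerProductSpace ℂ H] (π : ProjUnitaryRep G H)

theorem exists_map_mul (x y : G) :
    ∃ c : Circle, ∀ f : H, π (x * y) f = (c : ℂ) • π x (π y f) := by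
  obtain ⟨σ, hσ⟩ := π.exists_cocycle
  exact ⟨σ x y, hσ x y⟩

theorem exists_map_one : ∃ c : Circle, ∀ f : H, π 1 f = (c : ℂ) • f := by
  obtain ⟨c, hc⟩ := π.exists_map_mul 1 1
  refine ⟨c⁻¹, fun f => ?_⟩
  have h : f = (c : ℂ) • π 1 f := (π 1).injective (by simpa using hc f)
  conv_rhs => rw [h, smul_smul]
  simp

theorem exists_map_inv (x : G) :
    ∃ c : Circle, ∀ f : H, (π x).symm f = (c : ℂ) • π x⁻¹ f := by
  obtain ⟨c, hc⟩ := π.exists_map_mul x x⁻¹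
  obtain ⟨e, he⟩ := π.exists_map_one
  refine ⟨e⁻¹ * c, fun f => ?_⟩
  have h : (e : ℂ) • f = (c : ℂ) • π x (π x⁻¹ f) := by rw [← he, ← hc, mul_inv_cancel]
  rw [LinearIsometryEquiv.symm_apply_eq, map_smul, Circle.coe_mul, ← smul_smul, ← h, smul_smul]
  simp

theorem norm_inner_map_map (x y : G) (f h : H) :
    ‖inner ℂ (π x f) (π y h)‖ = ‖inner ℂ f (π (x⁻¹ * y) h)‖ := by
  obtain ⟨c, hc⟩ := π.exists_map_mul x (x⁻¹ * y)
  have hy : π y h = (c : ℂ) • π x (π (x⁻¹ * y) h) := by rw [← hc, mul_inv_cancel_left]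
  rw [hy, inner_smul_right, LinearIsometryEquiv.inner_map_map, norm_mul, Circle.norm_coe, one_mul]

theorem norm_coeff_swap (g f : H) (x : G) : ‖π.coeff g f x‖ = ‖π.coeff f g x⁻¹‖ := by
  obtain ⟨c, hc⟩ := π.exists_map_inv x
  have h := (π x).inner_map_map g ((π x).symm f)
  rw [LinearIsometryEquiv.apply_symm_apply, hc] at h
  rw [coeff, h, coeff, inner_smul_right, norm_mul, Circle.norm_coe, one_mul, norm_inner_symm]

theorem norm_coeff_map (g f : H) (y x : G) :
    ‖π.coeff g (π y f) x‖ = ‖π.coeff g f (y⁻¹ * x)‖ := by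
  rw [coeff, norm_inner_symm, norm_inner_map_map, coeff, norm_inner_symm]

theorem norm_coeff_le (g f : H) (x : G) : ‖π.coeff g f x‖ ≤ ‖g‖ * ‖f‖ := by
  simpa [coeff] using norm_inner_le_norm (𝕜 := ℂ) (π x g) f

theorem stronglyMeasurable_coeff (g f : H) : StronglyMeasurable (π.coeff g f) :=
  (π.stronglyMeasurable g).inner stronglyMeasurable_const

variable {π}

/-- The kernel of an intertwiner is a closed invariant subspace. -/
theorem IsIrreducible.eq_zero_or_eq_zero_of_mul_eq_zero (hπ : π.IsIrreducible) {A B : H →L[ℂ] H}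
    (hA : ∀ x f, A (π x f) = π x (A f)) (hAB : A * B = 0) : A = 0 ∨ B = 0 := by
  have hinv : ∀ x : G, ∀ f ∈ A.ker, π x f ∈ A.ker := fun x f hf => by
    simp_all
  rcases hπ A.ker A.isClosed_ker hinv with h | h
  · right
    ext f
    have hf : B f ∈ A.ker := DFunLike.congr_fun hAB f
    simpa [h] using hf
  · left
    ext f
    have hf : f ∈ A.ker := h ▸ Submodule.mem_top
    exact hf

variable [CompleteSpace H]

/-- If the spectrum had points on both sides of `m`, then the positive and negative parts of
`A - m` would be non-zero intertwiners with product zero. -/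
theorem IsIrreducible.spectrum_subsingleton (hπ : π.IsIrreducible) {A : H →L[ℂ] H}
    (hA : IsSelfAdjoint A) (hcomm : ∀ x f, A (π x f) = π x (A f)) :
    (spectrum ℝ A).Subsingleton := by
  by_contra hsub
  obtain ⟨a, ha, b, hb, hab⟩ := (Set.not_subsingleton_iff.1 hsub).exists_lt
  obtain ⟨m, ham, hmb⟩ := exists_between hab
  let p : ℝ → ℝ := fun t => max 0 (m - t)
  let q : ℝ → ℝ := fun t => max 0 (t - m)
  have hp : Continuous p := by fun_prop
  have hq : Continuous q := by fun_prop
  have hpq : cfc p A * cfc q A = 0 := by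
    have h0 : (fun t => p t * q t) = fun _ => 0 := by
      ext t
      rcases le_total m t with h | h <;> simp [p, q, h]
    rw [← cfc_mul p q A hp.continuousOn hq.continuousOn, h0, cfc_const_zero]
  have hcommp : ∀ x f, cfc p A (π x f) = π x (cfc p A f) := fun x f => by
    let U : H →L[ℂ] H := (π x : H ≃L[ℂ] H)
    have hU : Commute A U := ContinuousLinearMap.ext (hcomm x)
    exact DFunLike.congr_fun (hU.cfc_real p) f
  have hne : ∀ r : ℝ → ℝ, Continuous r → ∀ t ∈ spectrum ℝ A, r t ≠ 0 → cfc r A ≠ 0 :=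
    fun r hr t ht hrt h0 => hrt <| eqOn_of_cfc_eq_cfc (g := fun _ => 0)
      (by rw [h0, cfc_const_zero]) hr.continuousOn continuousOn_const hA ht
  rcases hπ.eq_zero_or_eq_zero_of_mul_eq_zero hcommp hpq with h | h
  · exact hne p hp a ha (by simp [p, ham]) h
  · exact hne q hq b hb (by simp [q, hmb]) h

theorem IsIrreducible.exists_eq_smul_one (hπ : π.IsIrreducible) {A : H →L[ℂ] H}
    (hA : IsSelfAdjoint A) (hcomm : ∀ x f, A (π x f) = π x (A f)) :
    ∃ c : ℝ, A = c • (1 : H →L[ℂ] H) := by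
  have h := (hπ.spectrum_subsingleton hA hcomm).eq_empty_or_singleton
  obtain ⟨c, hc⟩ : ∃ c : ℝ, spectrum ℝ A ⊆ {c} := by
    rcases h with h | ⟨c, hc⟩
    · exact ⟨0, by simp [h]⟩
    · exact ⟨c, hc.le⟩
  exact ⟨c, by simpa [Algebra.algebraMap_eq_smul_one] using
    CFC.eq_algebraMap_of_spectrum_subset_singleton A c hc hA⟩

end Algebra

section Graph

variable {G : Type*} [Group G] [MeasurableSpace G]
  {H : Type*} [NormedAddCommGroup H] [InnerProductSpace ℂ H] (π : ProjUnitaryRep G H)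

/-- The graph of the (possibly unbounded) operator `f ↦ V_g f` from `H` to `L²(G)`, as a subspace
of the Hilbert space sum of the two. -/
noncomputable def coeffGraph (μ : Measure G) (g : H) : Submodule ℂ (WithLp 2 (H × Lp ℂ 2 μ)) where
  carrier := {p | p.snd =ᵐ[μ] π.coeff g p.fst}
  add_mem' {p q} hp hq := by
    filter_upwards [hp, hq, Lp.coeFn_add p.snd q.snd] with x h1 h2 h3
    simp only [WithLp.add_snd, WithLp.add_fst, coeff, inner_add_right] at h1 h2 h3 ⊢
    rw [h3, Pi.add_apply, h1, h2]
  zero_mem' := by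
    filter_upwards [Lp.coeFn_zero ℂ 2 μ] with x h1
    simpa [coeff] using h1
  smul_mem' c p hp := by
    filter_upwards [hp, Lp.coeFn_smul c p.snd] with x h1 h2
    simp only [WithLp.smul_snd, WithLp.smul_fst, coeff, inner_smul_right] at h1 h2 ⊢
    rw [h2, Pi.smul_apply, h1, smul_eq_mul]

theorem isClosed_coeffGraph (μ : Measure G) (g : H) :
    IsClosed (π.coeffGraph μ g : Set (WithLp 2 (H × Lp ℂ 2 μ))) := by
  refine IsSeqClosed.isClosed fun p q hp hlim => ?_
  have hfst : Tendsto (fun n => (p n).fst) atTop (𝓝 q.fst) :=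
    ((WithLp.fstL 2 ℂ H (Lp ℂ 2 μ)).continuous.tendsto q).comp hlim
  have hsnd : Tendsto (fun n => (p n).snd) atTop (𝓝 q.snd) :=
    ((WithLp.sndL 2 ℂ H (Lp ℂ 2 μ)).continuous.tendsto q).comp hlim
  obtain ⟨ns, hns, hae⟩ := (tendstoInMeasure_of_tendsto_Lp hsnd).exists_seq_tendsto_ae
  have hmem : ∀ᵐ x ∂μ, ∀ n, (p n).snd x = π.coeff g (p n).fst x := ae_all_iff.2 hp
  change q.snd =ᵐ[μ] π.coeff g q.fst
  filter_upwards [hae, hmem] with x hx hx'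
  have hcoeff : Tendsto (fun n => π.coeff g (p (ns n)).fst x) atTop (𝓝 (π.coeff g q.fst x)) :=
    (tendsto_const_nhds.inner hfst).comp hns.tendsto_atTop
  simp_rw [← hx'] at hcoeff
  exact tendsto_nhds_unique hx hcoeff

/-- The projection of the graph of `f ↦ V_g f` to its domain. -/
noncomputable def coeffGraphFst (μ : Measure G) (g : H) : π.coeffGraph μ g →L[ℂ] H :=
  (WithLp.fstL 2 ℂ H (Lp ℂ 2 μ)).comp (π.coeffGraph μ g).subtypeL

variable {μ : Measure G} {g f : H}

/-- The element of the graph lying above a vector `f` with `V_g f ∈ L²(G)`. -/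
noncomputable def coeffGraphMk (hf : MemLp (π.coeff g f) 2 μ) : π.coeffGraph μ g :=
  ⟨WithLp.toLp 2 (f, hf.toLp _), hf.coeFn_toLp⟩

theorem coeffGraphFst_mk (hf : MemLp (π.coeff g f) 2 μ) :
    π.coeffGraphFst μ g (π.coeffGraphMk hf) = f := rfl

theorem memLp_coeff_coeffGraphFst (p : π.coeffGraph μ g) :
    MemLp (π.coeff g (π.coeffGraphFst μ g p)) 2 μ :=
  (memLp_congr_ae p.2).1 (Lp.memLp _)

theorem inner_coeffGraph (p q : π.coeffGraph μ g) :
    inner ℂ p q = inner ℂ (π.coeffGraphFst μ g p) (π.coeffGraphFst μ g q)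
      + ∫ x, inner ℂ (π.coeff g (π.coeffGraphFst μ g p) x)
          (π.coeff g (π.coeffGraphFst μ g q) x) ∂μ := by
  rw [Submodule.coe_inner, WithLp.prod_inner_apply, L2.inner_def]
  congr 1
  refine integral_congr_ae ?_
  filter_upwards [p.2, q.2] with x h1 h2
  exact congrArg₂ (inner ℂ) h1 h2

variable [MeasurableMul G] [μ.IsMulLeftInvariant]

theorem memLp_coeff_map (hf : MemLp (π.coeff g f) 2 μ) (y : G) :
    MemLp (π.coeff g (π y f)) 2 μ :=
  (hf.comp_measurePreserving (measurePreserving_mul_left μ y⁻¹)).congr_norm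
    (π.stronglyMeasurable_coeff g _).aestronglyMeasurable
    (Eventually.of_forall fun x => (π.norm_coeff_map g f y x).symm)

theorem memLp_coeff_symm (hf : MemLp (π.coeff g f) 2 μ) (y : G) :
    MemLp (π.coeff g ((π y).symm f)) 2 μ := by
  obtain ⟨c, hc⟩ := π.exists_map_inv y
  refine (π.memLp_coeff_map hf y⁻¹).congr_norm
    (π.stronglyMeasurable_coeff g _).aestronglyMeasurable (Eventually.of_forall fun x => ?_)
  rw [hc, coeff, coeff, inner_smul_right, norm_mul, Circle.norm_coe, one_mul]

theorem integral_inner_coeff_map (g f h : H) (y : G) :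
    ∫ x, inner ℂ (π.coeff g (π y f) x) (π.coeff g (π y h) x) ∂μ
      = ∫ x, inner ℂ (π.coeff g f x) (π.coeff g h x) ∂μ := by
  rw [← integral_mul_left_eq_self (μ := μ)
    (fun x => inner ℂ (π.coeff g (π y f) x) (π.coeff g (π y h) x)) y]
  congr 1 with x
  obtain ⟨c, hc⟩ := π.exists_map_mul y x
  have hphase : ∀ k : H, π.coeff g (π y k) (y * x) = starRingEnd ℂ c * π.coeff g k x := fun k => by
    rw [coeff, hc, inner_smul_left, LinearIsometryEquiv.inner_map_map, coeff]
  have hcc : (c : ℂ) * starRingEnd ℂ c = 1 := by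
    rw [Complex.mul_conj, Circle.normSq_coe, Complex.ofReal_one]
  simp only [hphase, RCLike.inner_apply, map_mul, Complex.conj_conj]
  linear_combination (π.coeff g h x * starRingEnd ℂ (π.coeff g f x)) * hcc

theorem inner_coeffGraph_map {p p' q q' : π.coeffGraph μ g} {y : G}
    (hp : π.coeffGraphFst μ g p' = π y (π.coeffGraphFst μ g p))
    (hq : π.coeffGraphFst μ g q' = π y (π.coeffGraphFst μ g q)) : inner ℂ p' q' = inner ℂ p q := by
  rw [inner_coeffGraph, hp, hq, integral_inner_coeff_map, LinearIsometryEquiv.inner_map_map,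
    ← inner_coeffGraph]

theorem exists_coeffGraphFst_eq_map (p : π.coeffGraph μ g) (y : G) :
    ∃ q, π.coeffGraphFst μ g q = π y (π.coeffGraphFst μ g p) :=
  ⟨π.coeffGraphMk (π.memLp_coeff_map (π.memLp_coeff_coeffGraphFst p) y), rfl⟩

theorem exists_map_coeffGraphFst_eq (p : π.coeffGraph μ g) (y : G) :
    ∃ q, π y (π.coeffGraphFst μ g q) = π.coeffGraphFst μ g p :=
  ⟨π.coeffGraphMk (π.memLp_coeff_symm (π.memLp_coeff_coeffGraphFst p) y),
    (π y).apply_symm_apply _⟩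

variable [CompleteSpace H]

instance (μ : Measure G) (g : H) : CompleteSpace (π.coeffGraph μ g) :=
  (π.isClosed_coeffGraph μ g).completeSpace_coe

theorem coeffGraphFst_adjoint_map (f : H) (y : G) :
    π.coeffGraphFst μ g ((π.coeffGraphFst μ g).adjoint (π y f))
      = π y (π.coeffGraphFst μ g ((π.coeffGraphFst μ g).adjoint f)) := by
  set ι := π.coeffGraphFst μ g
  obtain ⟨q, hq⟩ := π.exists_coeffGraphFst_eq_map (ι.adjoint f) y
  have hadj : ι.adjoint (π y f) = q := by
    refine ext_inner_right ℂ fun w => ?_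
    obtain ⟨v, hv⟩ := π.exists_map_coeffGraphFst_eq w y
    rw [ContinuousLinearMap.adjoint_inner_left, ← hv, LinearIsometryEquiv.inner_map_map,
      ← ContinuousLinearMap.adjoint_inner_left]
    exact (π.inner_coeffGraph_map hq hv.symm).symm
  rw [hadj, hq]

variable {π}

/-- Schur's lemma applied to `ι ι†`, where `ι` is the projection of the graph of `f ↦ V_g f` to
its domain: `ι ι† = c` with `c ≠ 0`, so `ι` is onto and `f ↦ V_g f` is everywhere defined. -/
theorem IsIrreducible.exists_integral_inner_coeff (hπ : π.IsIrreducible) {f₀ : H} (hf₀ : f₀ ≠ 0)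
    (h₀ : MemLp (π.coeff g f₀) 2 μ) :
    ∃ C : ℝ, (∀ f : H, MemLp (π.coeff g f) 2 μ) ∧
      ∀ f h : H, ∫ x, inner ℂ (π.coeff g f x) (π.coeff g h x) ∂μ = C * inner ℂ f h := by
  set ι := π.coeffGraphFst μ g
  have hsa : IsSelfAdjoint (ι.comp ι.adjoint) := by
    simp [ContinuousLinearMap.isSelfAdjoint_iff', ContinuousLinearMap.adjoint_comp]
  obtain ⟨c, hc⟩ := hπ.exists_eq_smul_one hsa fun x f => π.coeffGraphFst_adjoint_map f x
  have hιι : ∀ f, ι (ι.adjoint f) = (c : ℂ) • f := fun f => by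
    simpa using DFunLike.congr_fun hc f
  have hc0 : (c : ℂ) ≠ 0 := by
    intro h0
    have hadj : ι.adjoint f₀ = 0 := by
      rw [← inner_self_eq_zero (𝕜 := ℂ), ContinuousLinearMap.adjoint_inner_left, hιι, h0,
        zero_smul, inner_zero_right]
    have := ContinuousLinearMap.adjoint_inner_left ι (π.coeffGraphMk h₀) f₀
    rw [hadj, inner_zero_left] at this
    exact hf₀ (inner_self_eq_zero.1 this.symm)
  have hlift : ∀ f, ι (ι.adjoint ((c : ℂ)⁻¹ • f)) = f := fun f => by
    rw [hιι, smul_inv_smul₀ hc0]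
  have hmem : ∀ f, MemLp (π.coeff g f) 2 μ := fun f =>
    hlift f ▸ π.memLp_coeff_coeffGraphFst (ι.adjoint ((c : ℂ)⁻¹ • f))
  refine ⟨c⁻¹ - 1, hmem, fun f h => ?_⟩
  have hinner := ContinuousLinearMap.adjoint_inner_left ι (π.coeffGraphMk (hmem h)) ((c : ℂ)⁻¹ • f)
  rw [inner_coeffGraph, coeffGraphFst_mk, hlift, inner_smul_left, map_inv₀,
    Complex.conj_ofReal] at hinner
  push_cast
  linear_combination hinner

end Graph

section FormalDegree

variable {G : Type*} [Group G] [MeasurableSpace G]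
  {H : Type*} [NormedAddCommGroup H] [InnerProductSpace ℂ H] {π : ProjUnitaryRep G H}
  {μ : Measure G}

theorem memLp_two_coeff_of_integrable {g f : H} (h : Integrable (π.coeff g f) μ) :
    MemLp (π.coeff g f) 2 μ := by
  rw [memLp_two_iff_integrable_sq_norm (π.stronglyMeasurable_coeff g f).aestronglyMeasurable]
  refine (h.norm.const_mul (‖g‖ * ‖f‖)).mono'
    ((π.stronglyMeasurable_coeff g f).norm.pow 2).aestronglyMeasurable
    (Eventually.of_forall fun x => ?_)
  rw [norm_pow, norm_norm, pow_two]
  gcongr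
  exact π.norm_coeff_le g f x

theorem exists_coeff_not_ae_zero (π : ProjUnitaryRep G H) [NeZero μ] {g : H} (hg : g ≠ 0) :
    ∃ f : H, ¬ π.coeff g f =ᵐ[μ] 0 := by
  by_contra! hcon
  obtain ⟨D, hDc, hD⟩ := (π.stronglyMeasurable g).isSeparable_range
  have hall : ∀ᵐ x ∂μ, ∀ d ∈ D, inner ℂ (π x g) d = 0 :=
    (ae_ball_iff hDc).2 fun d _ => hcon d
  obtain ⟨x, hx⟩ := hall.exists
  have hclosed : IsClosed {v : H | inner ℂ (π x g) v = 0} :=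
    isClosed_eq (by fun_prop) continuous_const
  have hself : inner ℂ (π x g) (π x g) = 0 := closure_minimal hx hclosed (hD ⟨x, rfl⟩)
  exact hg (by simpa using hself)

theorem integral_norm_sq_coeff_swap [MeasurableInv G] [μ.IsInvInvariant] (f g : H) :
    ∫ x, ‖π.coeff g f x‖ ^ 2 ∂μ = ∫ x, ‖π.coeff f g x‖ ^ 2 ∂μ := by
  rw [← integral_inv_eq_self]
  simp_rw [π.norm_coeff_swap g f, inv_inv]

theorem memLp_coeff_swap [MeasurableInv G] [μ.IsInvInvariant] {f g : H}
    (h : MemLp (π.coeff g f) 2 μ) : MemLp (π.coeff f g) 2 μ :=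
  (h.comp_measurePreserving (Measure.measurePreserving_inv μ)).congr_norm
    (π.stronglyMeasurable_coeff f g).aestronglyMeasurable
    (Eventually.of_forall fun x => (π.norm_coeff_swap f g x).symm)

theorem integral_inner_coeff_self (f g : H) :
    ∫ x, inner ℂ (π.coeff g f x) (π.coeff g f x) ∂μ = (∫ x, ‖π.coeff g f x‖ ^ 2 ∂μ : ℝ) := by
  rw [← integral_complex_ofReal]
  simp_rw [inner_self_eq_norm_sq_to_K (𝕜 := ℂ)]
  simp

theorem IsIntegrableRep.exists_integral_inner_coeff [CompleteSpace H] [MeasurableMul G]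
    [MeasurableInv G] [μ.IsMulLeftInvariant] [μ.IsInvInvariant] (hπ : π.IsIntegrableRep μ) :
    ∃ κ : ℝ, ∀ g : H, (∀ f, MemLp (π.coeff g f) 2 μ) ∧
      ∀ f h, ∫ x, inner ℂ (π.coeff g f x) (π.coeff g h x) ∂μ = κ * ‖g‖ ^ 2 * inner ℂ f h := by
  obtain ⟨g₀, hg₀, hint⟩ := hπ.exists_integrable_vector
  obtain ⟨C, hmem, hC⟩ := hπ.irreducible.exists_integral_inner_coeff hg₀
    (memLp_two_coeff_of_integrable hint)
  have hnorm : (‖g₀‖ : ℂ) ≠ 0 := by simpa using hg₀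
  refine ⟨C / ‖g₀‖ ^ 2, fun g => ?_⟩
  obtain ⟨D, hmem', hD⟩ := hπ.irreducible.exists_integral_inner_coeff hg₀
    (memLp_coeff_swap (hmem g))
  refine ⟨hmem', fun f h => ?_⟩
  have hCD : (D : ℂ) * ‖g₀‖ ^ 2 = C * ‖g‖ ^ 2 := by
    have h1 := hD g₀ g₀
    have h2 := hC g g
    rw [integral_inner_coeff_self, inner_self_eq_norm_sq_to_K] at h1 h2
    rw [integral_norm_sq_coeff_swap] at h1
    exact h1.symm.trans h2
  rw [hD f h]
  push_cast
  field_simp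
  linear_combination inner ℂ f h * hCD

theorem integrable_inner_mul_inner {f₁ f₂ g₁ g₂ : H} (h₁ : MemLp (π.coeff g₁ f₁) 2 μ)
    (h₂ : MemLp (π.coeff g₂ f₂) 2 μ) :
    Integrable (fun x => inner ℂ (π x g₁) f₁ * inner ℂ f₂ (π x g₂)) μ := by
  simpa [coeff, Pi.star_def, Pi.mul_def] using h₁.integrable_mul h₂.star

/-- The left-hand side of the orthogonality relations, as a sesquilinear form in the windows. -/
noncomputable def coeffForm {f₁ f₂ : H} (h₁ : ∀ g, MemLp (π.coeff g f₁) 2 μ)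
    (h₂ : ∀ g, MemLp (π.coeff g f₂) 2 μ) : H →ₗ⋆[ℂ] H →ₗ[ℂ] ℂ :=
  LinearMap.mk₂'ₛₗ _ _ (fun g₁ g₂ => ∫ x, inner ℂ (π x g₁) f₁ * inner ℂ f₂ (π x g₂) ∂μ)
    (fun g g' k => by
      simp only [map_add, inner_add_left, add_mul]
      exact integral_add (integrable_inner_mul_inner (h₁ g) (h₂ k))
        (integrable_inner_mul_inner (h₁ g') (h₂ k)))
    (fun c g k => by
      simp only [map_smul, inner_smul_left, mul_assoc]
      exact integral_const_mul _ _)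
    (fun k g g' => by
      simp only [map_add, inner_add_right, mul_add]
      exact integral_add (integrable_inner_mul_inner (h₁ k) (h₂ g))
        (integrable_inner_mul_inner (h₁ k) (h₂ g')))
    (fun c k g => by
      simp only [map_smul, inner_smul_right, mul_left_comm _ c]
      exact integral_const_mul _ _)

variable [CompleteSpace H] [MeasurableMul G] [MeasurableInv G] [NeZero μ] [μ.IsMulLeftInvariant]
  [μ.IsInvInvariant]

theorem IsIntegrableRep.exists_isFormalDegree (hπ : π.IsIntegrableRep μ) :
    ∃ d : ℝ, π.IsFormalDegree μ d := by
  obtain ⟨κ, hκ⟩ := hπ.exists_integral_inner_coeff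
  have hmem : ∀ f g, MemLp (π.coeff g f) 2 μ := fun f g => (hκ g).1 f
  have hκ0 : 0 < κ := by
    obtain ⟨g, hg, -⟩ := hπ.exists_integrable_vector
    obtain ⟨f, hf⟩ := π.exists_coeff_not_ae_zero (μ := μ) hg
    have heq : ∫ x, ‖π.coeff g f x‖ ^ 2 ∂μ = κ * ‖g‖ ^ 2 * ‖f‖ ^ 2 := by
      have h := (hκ g).2 f f
      simp only [inner_self_eq_norm_sq_to_K, Complex.coe_algebraMap] at h
      exact_mod_cast h
    have hpos : 0 < ∫ x, ‖π.coeff g f x‖ ^ 2 ∂μ := by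
      refine (integral_nonneg fun x => by positivity).lt_of_ne' fun h0 => hf ?_
      rw [integral_eq_zero_iff_of_nonneg (fun x => by positivity)
        ((memLp_two_iff_integrable_sq_norm (hmem f g).1).1 (hmem f g))] at h0
      filter_upwards [h0] with x hx
      simpa using hx
    rw [heq, mul_assoc] at hpos
    exact pos_of_mul_pos_left hpos (by positivity)
  refine ⟨κ⁻¹, inv_pos.2 hκ0, fun f₁ f₂ g₁ g₂ =>
    ⟨integrable_inner_mul_inner (hmem f₁ g₁) (hmem f₂ g₂), ?_⟩⟩
  have halt : (coeffForm (hmem f₁) (hmem f₂) - (κ * inner ℂ f₂ f₁) • innerₛₗ ℂ).IsAlt := fun g => by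
    have h : coeffForm (hmem f₁) (hmem f₂) g g = κ * ‖g‖ ^ 2 * inner ℂ f₂ f₁ := by
      rw [← (hκ g).2 f₂ f₁]
      simp [coeffForm, coeff]
    simp only [LinearMap.sub_apply, LinearMap.smul_apply, h, innerₛₗ_apply_apply, smul_eq_mul,
      inner_self_eq_norm_sq_to_K (𝕜 := ℂ) g, Complex.coe_algebraMap]
    ring
  have h := LinearMap.congr_fun₂ (sesquilinForm_eq_zero_of_isAlt halt) g₁ g₂
  simp only [LinearMap.sub_apply, LinearMap.smul_apply, innerₛₗ_apply_apply, smul_eq_mul,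
    LinearMap.zero_apply, sub_eq_zero] at h
  simpa [inner_conj_symm, coeffForm] using h

theorem IsIntegrableRep.isFormalDegree_formalDegree (hπ : π.IsIntegrableRep μ) :
    π.IsFormalDegree μ (π.formalDegree μ) :=
  Classical.epsilon_spec hπ.exists_isFormalDegree

end FormalDegree

end ProjUnitaryRep

/-! ### Continuity of matrix coefficients -/

namespace ProjUnitaryRep

variable {G : Type*} [Group G] [TopologicalSpace G] [IsTopologicalGroup G]
  [LocallyCompactSpace G] [SecondCountableTopology G] [MeasurableSpace G] [BorelSpace G]
  {H : Type*} [NormedAddCommGroup H] [InnerProductSpace ℂ H] (π : ProjUnitaryRep G H)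

/-- The orbit of `g` is separable, so `{x | ‖π x g - d‖ < ε / 2}` has positive measure for some
`d`, and Steinhaus' theorem applies to this set. -/
theorem eventually_exists_norm_map_sub_smul_lt (g : H) {ε : ℝ} (hε : 0 < ε) :
    ∀ᶠ u in 𝓝 (1 : G), ∃ c : Circle, ‖π u g - (c : ℂ) • g‖ < ε := by
  let ν : Measure G := Measure.haar
  obtain ⟨D, hDc, hD⟩ := (π.stronglyMeasurable g).isSeparable_range
  let E : H → Set G := fun d => {x | ‖π x g - d‖ < ε / 2}
  have hE : ∀ d, MeasurableSet (E d) := fun d =>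
    ((π.stronglyMeasurable g).sub stronglyMeasurable_const).norm.measurable measurableSet_Iio
  have hcov : ⋃ d ∈ D, E d = Set.univ := by
    refine Set.eq_univ_of_forall fun x => ?_
    obtain ⟨d, hd, hdist⟩ := Metric.mem_closure_iff.1 (hD ⟨x, rfl⟩) (ε / 2) (by positivity)
    exact Set.mem_biUnion hd (by simpa [E, dist_eq_norm] using hdist)
  obtain ⟨d, -, hd⟩ : ∃ d ∈ D, ν (E d) ≠ 0 := by
    by_contra! hnull
    have h0 := (measure_biUnion_null_iff hDc).2 hnull
    rw [hcov] at h0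
    exact NeZero.ne ν (Measure.measure_univ_eq_zero.1 h0)
  have hpos : 0 < ν (E d)⁻¹ := pos_iff_ne_zero.2 fun h => hd ((measure_inv_null ν).1 h)
  filter_upwards [Measure.div_mem_nhds_one_of_haar_pos ν _ (hE d).inv hpos] with u hu
  obtain ⟨a, ha, b, hb, rfl⟩ := Set.mem_div.1 hu
  have ha' : ‖π a⁻¹ g - d‖ < ε / 2 := ha
  have hb' : ‖π b⁻¹ g - d‖ < ε / 2 := hb
  obtain ⟨c, hc⟩ := π.exists_map_mul a⁻¹ (a / b)
  refine ⟨c⁻¹, ?_⟩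
  have hphase : π a⁻¹ (π (a / b) g) = ((c⁻¹ : Circle) : ℂ) • π b⁻¹ g := by
    have hab : b⁻¹ = a⁻¹ * (a / b) := by rw [div_eq_mul_inv, inv_mul_cancel_left]
    rw [hab, hc g, smul_smul, ← Circle.coe_mul, inv_mul_cancel, Circle.coe_one, one_smul]
  rw [← (π a⁻¹).norm_map, map_sub, map_smul, hphase, ← smul_sub, norm_smul, Circle.norm_coe,
    one_mul]
  calc ‖π b⁻¹ g - π a⁻¹ g‖ = ‖(π b⁻¹ g - d) - (π a⁻¹ g - d)‖ := by congr 1; abel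
    _ ≤ ‖π b⁻¹ g - d‖ + ‖π a⁻¹ g - d‖ := norm_sub_le _ _
    _ < ε := by linarith

theorem continuous_norm_coeff (g f : H) : Continuous fun x => ‖π.coeff g f x‖ := by
  refine continuous_iff_continuousAt.2 fun x => Metric.tendsto_nhds.2 fun ε hε => ?_
  rw [← map_mul_left_nhds_one x, eventually_map]
  have hf : 0 < ‖f‖ + 1 := by positivity
  filter_upwards [π.eventually_exists_norm_map_sub_smul_lt g (div_pos hε hf)] with u hu
  obtain ⟨c, hc⟩ := hu
  obtain ⟨e, he⟩ := π.exists_map_mul x u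
  have hxu : ‖π.coeff g f (x * u)‖ = ‖inner ℂ (π x (π u g)) f‖ := by
    rw [coeff, he, inner_smul_left, norm_mul, RCLike.norm_conj, Circle.norm_coe, one_mul]
  have hx : ‖π.coeff g f x‖ = ‖inner ℂ (π x ((c : ℂ) • g)) f‖ := by
    rw [coeff, map_smul, inner_smul_left, norm_mul, RCLike.norm_conj, Circle.norm_coe, one_mul]
  calc dist ‖π.coeff g f (x * u)‖ ‖π.coeff g f x‖
      ≤ ‖inner ℂ (π x (π u g)) f - inner ℂ (π x ((c : ℂ) • g)) f‖ := by
        rw [Real.dist_eq, hxu, hx]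
        exact abs_norm_sub_norm_le _ _
    _ ≤ ‖π u g - (c : ℂ) • g‖ * ‖f‖ := by
        rw [← inner_sub_left, ← map_sub, ← (π x).norm_map (π u g - (c : ℂ) • g)]
        exact norm_inner_le_norm _ _
    _ ≤ ‖π u g - (c : ℂ) • g‖ * (‖f‖ + 1) := by gcongr; linarith
    _ < ε := (lt_div_iff₀ hf).1 hc

/-- By continuity of `|V_g f|`, its essential supremum over `x z Q` dominates its value at the
interior point `x` of that set. -/
theorem enorm_coeff_le_localMaximal (μ : Measure G) [μ.IsOpenPosMeasure] {Q : Set G}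
    (hQs : Q⁻¹ = Q) (g f : H) (x : G) {z : G} (hz : z ∈ interior Q) :
    ‖π.coeff g f x‖ₑ ≤ localMaximal μ Q (π.coeff g f) (x * z) := by
  by_contra! hlt
  obtain ⟨s, hs1, hs2⟩ := exists_between hlt
  have hcont : Continuous fun y => ‖π.coeff g f y‖ₑ := by
    simp_rw [← ofReal_norm]
    exact ENNReal.continuous_ofReal.comp (π.continuous_norm_coeff g f)
  let O : Set G := {w | s < ‖π.coeff g f (x * z * w)‖ₑ} ∩ interior Q
  have hO : IsOpen O :=
    (isOpen_lt continuous_const (hcont.comp (continuous_const_mul (x * z)))).inter isOpen_interior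
  have hinv : (interior Q)⁻¹ = interior Q :=
    ((Homeomorph.inv G).preimage_interior Q).trans (congrArg interior hQs)
  have hne : O.Nonempty := ⟨z⁻¹, by simpa using hs2, by rwa [← hinv, Set.inv_mem_inv]⟩
  have hlt_s : ∀ᵐ w ∂(μ.restrict O), ‖π.coeff g f (x * z * w)‖ₑ < s :=
    ae_mono (Measure.restrict_mono (Set.inter_subset_right.trans interior_subset) le_rfl)
      (ae_lt_of_essSup_lt hs1)
  rw [ae_restrict_iff' hO.measurableSet] at hlt_s
  refine hO.measure_ne_zero μ hne (measure_eq_zero_iff_ae_notMem.2 ?_)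
  filter_upwards [hlt_s] with w hw hwO
  exact (hw hwO).not_gt hwO.1

end ProjUnitaryRep

/-! ### Relative separation of Bessel orbits -/

section Separation

variable {G : Type*} [Group G] [TopologicalSpace G] [IsTopologicalGroup G]

theorem IsRelativelySeparated.exists_of_isCompact {Λ W Q : Set G} {n : ℕ}
    (hΛ : IsRelativelySeparated W n Λ) (hW : W ∈ 𝓝 (1 : G)) (hQ : IsCompact Q) :
    ∃ N, IsRelativelySeparated Q N Λ := by
  obtain ⟨t, -, ht⟩ := hQ.elim_nhds_subcover (fun y => y • W) fun y _ => by
    simpa using smul_mem_nhds_smul y hW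
  refine ⟨t.card * n, fun x => ?_⟩
  have hsub : Λ ∩ x • Q ⊆ ⋃ y ∈ t, Λ ∩ (x * y) • W := by
    rw [← Set.inter_iUnion₂]
    refine Set.inter_subset_inter_right _ ((Set.smul_set_mono ht).trans_eq ?_)
    simp_rw [Set.smul_set_iUnion, mul_smul]
  calc (Λ ∩ x • Q).encard ≤ ∑ y ∈ t, (Λ ∩ (x * y) • W).encard :=
        (Set.encard_le_encard hsub).trans (t.set_encard_biUnion_le _)
    _ ≤ ∑ _y ∈ t, (n : ℕ∞) := Finset.sum_le_sum fun y _ => hΛ _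
    _ = (t.card * n : ℕ) := by simp

variable [LocallyCompactSpace G] [SecondCountableTopology G] [MeasurableSpace G] [BorelSpace G]
  {H : Type*} [NormedAddCommGroup H] [InnerProductSpace ℂ H] (π : ProjUnitaryRep G H)

/-- Testing the Bessel inequality on `π x g` bounds the number of points in `x • W`, for a
neighbourhood `W` of `1` on which `|V_g g|` is bounded below. -/
theorem ProjUnitaryRep.exists_isRelativelySeparated {Λ Q : Set G} {g : H} (hg : g ≠ 0) {B : ℝ≥0∞}
    (hB : B ≠ ∞) (hbessel : ∀ f : H, ∑' l : Λ, ‖inner ℂ (π (l : G) g) f‖ₑ ^ 2 ≤ B * ‖f‖ₑ ^ 2)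
    (hQ : IsCompact Q) : ∃ N, IsRelativelySeparated Q N Λ := by
  have hcoeff1 : 0 < ‖π.coeff g g 1‖ := by
    obtain ⟨c, hc⟩ := π.exists_map_one
    rw [coeff, hc, inner_smul_left, norm_mul, RCLike.norm_conj, Circle.norm_coe, one_mul]
    simpa using pow_pos (norm_pos_iff.2 hg) 2
  obtain ⟨s, hs0, hs⟩ := exists_between hcoeff1
  let W : Set G := {w | s < ‖π.coeff g g w‖}
  have hW : W ∈ 𝓝 (1 : G) :=
    (isOpen_lt continuous_const (π.continuous_norm_coeff g g)).mem_nhds hs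
  have hs2 : ENNReal.ofReal s ^ 2 ≠ 0 := by simpa using hs0
  obtain ⟨n, hn⟩ := ENNReal.exists_nat_gt
    (ENNReal.div_ne_top (by finiteness : B * ‖g‖ₑ ^ 2 ≠ ∞) hs2)
  have hWn : IsRelativelySeparated W n Λ := fun x => by
    suffices h : ((Λ ∩ x • W).encard : ℝ≥0∞) ≤ B * ‖g‖ₑ ^ 2 / ENNReal.ofReal s ^ 2 by
      exact_mod_cast h.trans hn.le
    have hterm : ∀ l : Λ, (x • W).indicator 1 (l : G) * ENNReal.ofReal s ^ 2
        ≤ ‖inner ℂ (π (l : G) g) (π x g)‖ₑ ^ 2 := fun l => by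
      by_cases hl : (l : G) ∈ x • W
      · rw [Set.indicator_of_mem hl, Pi.one_apply, one_mul, ← ofReal_norm, norm_inner_symm,
          norm_inner_map_map, norm_inner_symm]
        gcongr
        exact (Set.mem_smul_set_iff_inv_smul_mem.1 hl).le
      · simp [hl]
    rw [ENNReal.le_div_iff_mul_le (.inl hs2) (.inl (by finiteness)),
      encard_inter_eq_tsum_indicator, ← ENNReal.tsum_mul_right]
    refine (ENNReal.tsum_le_tsum hterm).trans ((hbessel (π x g)).trans_eq ?_)
    rw [← ofReal_norm, LinearIsometryEquiv.norm_map, ofReal_norm]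
  exact hWn.exists_of_isCompact hW hQ

end Separation

/-! ### Localized kernels -/

section Kernel

variable {G : Type*} [Group G] [TopologicalSpace G]

/-- The kernel `k` on `X × Λ` has uniformly summable rows, and up to uniformly small row sums it
lives on the pairs `(y, z)` with `z ∈ y • C`, for a compact set `C`. -/
structure IsLocalizedKernel (X Λ : Set G) (k : G → G → ℝ≥0∞) : Prop where
  exists_row_bound : ∃ M : ℝ≥0, ∀ y ∈ X, ∑' z : Λ, k y z ≤ M
  exists_tail_bound : ∀ ε : ℝ≥0∞, ε ≠ 0 → ∃ C : Set G, IsCompact C ∧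
    ∀ y ∈ X, ∑' z : Λ, (y • C)ᶜ.indicator (k y) (z : G) ≤ ε

theorem exists_ne_zero_mul_le (M : ℝ≥0) {ε : ℝ≥0∞} (hε : ε ≠ 0) :
    ∃ δ : ℝ≥0∞, δ ≠ 0 ∧ M * δ ≤ ε := by
  refine ⟨ε / (M + 1), ENNReal.div_ne_zero.2 ⟨hε, by finiteness⟩, ?_⟩
  calc (M : ℝ≥0∞) * (ε / (M + 1)) ≤ (M + 1) * (ε / (M + 1)) := by gcongr; exact le_self_add
    _ ≤ ε := ENNReal.mul_div_le

variable {X X' Λ : Set G} {k k' : G → G → ℝ≥0∞}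

theorem IsLocalizedKernel.mono (hk : IsLocalizedKernel X Λ k) (hX : X' ⊆ X)
    (hle : ∀ y ∈ X', ∀ z ∈ Λ, k' y z ≤ k y z) : IsLocalizedKernel X' Λ k' := by
  obtain ⟨M, hM⟩ := hk.exists_row_bound
  refine ⟨⟨M, fun y hy =>
      (ENNReal.tsum_le_tsum fun z : Λ => hle y hy z z.2).trans (hM y (hX hy))⟩,
    fun ε hε => ?_⟩
  obtain ⟨C, hC, htail⟩ := hk.exists_tail_bound ε hε
  refine ⟨C, hC, fun y hy => (ENNReal.tsum_le_tsum fun z => ?_).trans (htail y (hX hy))⟩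
  by_cases hz : (z : G) ∈ y • C
  · simp [hz]
  · simpa [hz] using hle y hy z z.2

theorem IsLocalizedKernel.add (hk : IsLocalizedKernel X Λ k) (hk' : IsLocalizedKernel X Λ k') :
    IsLocalizedKernel X Λ (k + k') := by
  obtain ⟨M, hM⟩ := hk.exists_row_bound
  obtain ⟨M', hM'⟩ := hk'.exists_row_bound
  refine ⟨⟨M + M', fun y hy => ?_⟩, fun ε hε => ?_⟩
  · simp_rw [Pi.add_apply, ENNReal.tsum_add, ENNReal.coe_add]
    exact add_le_add (hM y hy) (hM' y hy)
  · obtain ⟨C, hC, htail⟩ := hk.exists_tail_bound (ε / 2) (by simpa using hε)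
    obtain ⟨C', hC', htail'⟩ := hk'.exists_tail_bound (ε / 2) (by simpa using hε)
    refine ⟨C ∪ C', hC.union hC', fun y hy => ?_⟩
    rw [← ENNReal.add_halves ε]
    refine le_trans ?_ (add_le_add (htail y hy) (htail' y hy))
    rw [← ENNReal.tsum_add]
    refine ENNReal.tsum_le_tsum fun z => ?_
    by_cases hz : (z : G) ∈ y • C <;> by_cases hz' : (z : G) ∈ y • C' <;>
      simp [Set.smul_set_union, hz, hz']

theorem IsLocalizedKernel.const_mul (c : ℝ≥0) (hk : IsLocalizedKernel X Λ k) :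
    IsLocalizedKernel X Λ (fun y z => c * k y z) := by
  obtain ⟨M, hM⟩ := hk.exists_row_bound
  refine ⟨⟨c * M, fun y hy => ?_⟩, fun ε hε => ?_⟩
  · rw [ENNReal.tsum_mul_left, ENNReal.coe_mul]
    gcongr
    exact hM y hy
  · obtain ⟨δ, hδ, hcδ⟩ := exists_ne_zero_mul_le c hε
    obtain ⟨C, hC, htail⟩ := hk.exists_tail_bound δ hδ
    refine ⟨C, hC, fun y hy => le_trans ?_ hcδ⟩
    simp_rw [Set.indicator_const_mul]
    rw [ENNReal.tsum_mul_left]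
    gcongr
    exact htail y hy

theorem tsum_tsum_mul_le {ι κ : Type*} {a : ι → ℝ≥0∞} {b : ι → κ → ℝ≥0∞} {M : ℝ≥0∞}
    (hb : ∀ i, ∑' j, b i j ≤ M) : ∑' j, ∑' i, a i * b i j ≤ (∑' i, a i) * M := by
  rw [ENNReal.tsum_comm, ← ENNReal.tsum_mul_right]
  refine ENNReal.tsum_le_tsum fun i => ?_
  rw [ENNReal.tsum_mul_left]
  gcongr
  exact hb i

/-- If `z ∉ y • (C * C')`, then each `l` has `l ∉ y • C` or `z ∉ l • C'`. -/
theorem IsLocalizedKernel.comp [IsTopologicalGroup G] (hk : IsLocalizedKernel X Λ k)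
    (hk' : IsLocalizedKernel Λ Λ k') :
    IsLocalizedKernel X Λ (fun y z => ∑' l : Λ, k y l * k' l z) := by
  obtain ⟨M, hM⟩ := hk.exists_row_bound
  obtain ⟨M', hM'⟩ := hk'.exists_row_bound
  refine ⟨⟨M * M', fun y hy => ?_⟩, fun ε hε => ?_⟩
  · rw [ENNReal.coe_mul]
    exact (tsum_tsum_mul_le fun l : Λ => hM' l l.2).trans (by gcongr; exact hM y hy)
  obtain ⟨δ, hδ, hMδ⟩ := exists_ne_zero_mul_le M' (ε := ε / 2) (by simpa using hε)
  obtain ⟨δ', hδ', hMδ'⟩ := exists_ne_zero_mul_le M (ε := ε / 2) (by simpa using hε)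
  obtain ⟨C, hC, htail⟩ := hk.exists_tail_bound δ hδ
  obtain ⟨C', hC', htail'⟩ := hk'.exists_tail_bound δ' hδ'
  refine ⟨C * C', hC.mul hC', fun y hy => ?_⟩
  have hsplit : ∀ z : Λ, (y • (C * C'))ᶜ.indicator (fun z => ∑' l : Λ, k y l * k' l z) (z : G)
      ≤ ∑' l : Λ, (y • C)ᶜ.indicator (k y) (l : G) * k' l z
        + ∑' l : Λ, k y l * ((l : G) • C')ᶜ.indicator (k' l) (z : G) := fun z => by
    by_cases hz : (z : G) ∈ y • (C * C')
    · simp [hz]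
    rw [Set.indicator_of_mem (by exact hz), ← ENNReal.tsum_add]
    refine ENNReal.tsum_le_tsum fun l => ?_
    by_cases hl : (l : G) ∈ y • C
    · have hz' : (z : G) ∉ (l : G) • C' := fun hz' => hz <| by
        rw [← smul_mul_assoc]
        exact Set.smul_set_subset_mul hl hz'
      simp [hz']
    · simp [hl]
  calc _ ≤ (∑' l : Λ, (y • C)ᶜ.indicator (k y) (l : G)) * M' + (∑' l : Λ, k y l) * δ' := by
        refine (ENNReal.tsum_le_tsum hsplit).trans ?_
        rw [ENNReal.tsum_add]
        exact add_le_add (tsum_tsum_mul_le fun l => hM' l l.2)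
          (tsum_tsum_mul_le fun l => htail' l l.2)
    _ ≤ M' * δ + M * δ' := by
        rw [mul_comm]
        gcongr
        · exact htail y hy
        · exact hM y hy
    _ ≤ ε := (add_le_add hMδ hMδ').trans_eq (ENNReal.add_halves ε)

end Kernel

theorem exists_isCompact_setLIntegral_compl_le {G : Type*} [TopologicalSpace G] [T2Space G]
    [SigmaCompactSpace G] [MeasurableSpace G] [BorelSpace G] (μ : Measure G) {F : G → ℝ≥0∞}
    (hF : ∫⁻ x, F x ∂μ ≠ ∞) {ε : ℝ≥0∞} (hε : ε ≠ 0) :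
    ∃ C : Set G, IsCompact C ∧ ∫⁻ x in Cᶜ, F x ∂μ ≤ ε := by
  let ν := μ.withDensity F
  have hν : ν Set.univ ≠ ∞ := by simpa [ν] using hF
  have hm : ∀ n, MeasurableSet (compactCovering G n) := fun n =>
    (isCompact_compactCovering G n).isClosed.measurableSet
  have hlim := tendsto_measure_iInter_atTop (μ := ν) (s := fun n => (compactCovering G n)ᶜ)
    (fun n => (hm n).compl.nullMeasurableSet)
    (fun m n hmn => Set.compl_subset_compl.2 (compactCovering_subset G hmn))
    ⟨0, ne_top_of_le_ne_top hν (measure_mono (Set.subset_univ _))⟩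
  rw [← Set.compl_iUnion, iUnion_compactCovering, Set.compl_univ, measure_empty] at hlim
  obtain ⟨n, hn⟩ := (hlim.eventually_le_const (pos_iff_ne_zero.2 hε)).exists
  refine ⟨_, isCompact_compactCovering G n, ?_⟩
  rwa [Function.comp_apply, withDensity_apply _ (hm n).compl] at hn

section Convolution

variable {G : Type*} [Group G] [TopologicalSpace G] [IsTopologicalGroup G] [T2Space G]
  [SecondCountableTopology G] [MeasurableSpace G] [BorelSpace G]
  {μ : Measure G} [μ.IsMulLeftInvariant] {Q Λ : Set G} {N : ℕ} {φ F : G → ℝ≥0∞}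

/-- For `l ∉ y • (C * Q)` the translate `(y⁻¹ * l) • Q` avoids `C`, so `φ (y⁻¹ * l)` is at most
the mean of `F` over `(y⁻¹ * l) • interior Q` outside `C`. -/
theorem IsRelativelySeparated.tsum_indicator_compl_mul_measure_le
    (hΛ : IsRelativelySeparated Q N Λ) (hQs : Q⁻¹ = Q) (hQ1 : Q ∈ 𝓝 (1 : G))
    (hF : AEMeasurable F μ) (hφ : ∀ w, ∀ z ∈ interior Q, φ w ≤ F (w * z)) {C : Set G}
    (hC : IsCompact C) (y : G) :
    (∑' l : Λ, (y • (C * Q))ᶜ.indicator (fun z => φ (y⁻¹ * z)) (l : G)) * μ (interior Q)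
      ≤ N * ∫⁻ x in Cᶜ, F x ∂μ := by
  have hCm : MeasurableSet Cᶜ := hC.isClosed.measurableSet.compl
  have hterm : ∀ l : Λ, (y • (C * Q))ᶜ.indicator (fun z => φ (y⁻¹ * z)) (l : G) * μ (interior Q)
      ≤ ∫⁻ v in (y⁻¹ * l) • interior Q, Cᶜ.indicator F v ∂μ := fun l => by
    by_cases hl : (l : G) ∈ y • (C * Q)
    · simp [hl]
    rw [Set.indicator_of_mem (by exact hl), ← measure_smul μ (y⁻¹ * (l : G)) (interior Q),
      ← setLIntegral_const]
    refine setLIntegral_mono' (isOpen_interior.measurableSet.const_smul _) ?_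
    rintro _ ⟨z, hz, rfl⟩
    have hzC : (y⁻¹ * l * z : G) ∈ Cᶜ := fun hzC => hl <| by
      refine Set.mem_smul_set_iff_inv_smul_mem.2 ⟨_, hzC, z⁻¹, ?_, by simp⟩
      rw [← hQs, Set.inv_mem_inv]
      exact interior_subset hz
    simpa [Set.indicator_of_mem hzC] using hφ (y⁻¹ * l) z hz
  rw [← lintegral_indicator hCm, ← ENNReal.tsum_mul_right]
  exact (ENNReal.tsum_le_tsum hterm).trans (hΛ.tsum_setLIntegral_smul_le hQs hQ1 interior_subset
    isOpen_interior.measurableSet (hF.indicator hCm) y)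

theorem IsRelativelySeparated.isLocalizedKernel [LocallyCompactSpace G] [μ.IsOpenPosMeasure]
    [IsFiniteMeasureOnCompacts μ] (hΛ : IsRelativelySeparated Q N Λ) (hQc : IsCompact Q)
    (hQs : Q⁻¹ = Q) (hQ1 : Q ∈ 𝓝 (1 : G)) (hF : AEMeasurable F μ) (hFint : ∫⁻ x, F x ∂μ ≠ ∞)
    (hφ : ∀ w, ∀ z ∈ interior Q, φ w ≤ F (w * z)) :
    IsLocalizedKernel Set.univ Λ (fun y z => φ (y⁻¹ * z)) := by
  have h0 : μ (interior Q) ≠ 0 :=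
    isOpen_interior.measure_ne_zero μ ⟨1, mem_interior_iff_mem_nhds.2 hQ1⟩
  have ht : μ (interior Q) ≠ ∞ := measure_ne_top_of_subset interior_subset hQc.measure_ne_top
  constructor
  · have hM : N * (∫⁻ x, F x ∂μ) / μ (interior Q) ≠ ∞ :=
      ENNReal.div_ne_top (by finiteness) h0
    refine ⟨(N * (∫⁻ x, F x ∂μ) / μ (interior Q)).toNNReal, fun y _ => ?_⟩
    rw [ENNReal.coe_toNNReal hM, ENNReal.le_div_iff_mul_le (.inl h0) (.inl ht)]
    simpa using hΛ.tsum_indicator_compl_mul_measure_le hQs hQ1 hF hφ isCompact_empty y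
  · intro ε hε
    obtain ⟨δ, hδ, hNδ⟩ := exists_ne_zero_mul_le (N : ℝ≥0) (mul_ne_zero hε h0)
    obtain ⟨C, hC, hCδ⟩ := exists_isCompact_setLIntegral_compl_le μ hFint hδ
    refine ⟨C * Q, hC.mul hQc, fun y _ => (ENNReal.mul_le_mul_iff_left h0 ht).1 ?_⟩
    calc _ ≤ N * ∫⁻ x in Cᶜ, F x ∂μ :=
          hΛ.tsum_indicator_compl_mul_measure_le hQs hQ1 hF hφ hC y
      _ ≤ N * δ := by gcongr
      _ ≤ ε * μ (interior Q) := by simpa using hNδ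

end Convolution

/-! ### Frames and their operators -/

theorem coe_mul_enorm_sq {E : Type*} [SeminormedAddGroup E] (c : ℝ≥0) (f : E) :
    (c : ℝ≥0∞) * ‖f‖ₑ ^ 2 = ENNReal.ofReal (c * ‖f‖ ^ 2) := by
  rw [ENNReal.ofReal_mul c.coe_nonneg, ENNReal.ofReal_pow (norm_nonneg f)]
  simp

section Frame

variable {ι : Type*} {H : Type*} [NormedAddCommGroup H] [InnerProductSpace ℂ H]

theorem hasSum_norm_sq_toReal {u : ι → ℂ} (hu : ∑' i, ‖u i‖ₑ ^ 2 ≠ ∞) :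
    HasSum (fun i => ‖u i‖ ^ 2) (∑' i, ‖u i‖ₑ ^ 2).toReal := by
  rw [ENNReal.tsum_toReal_eq fun i => by finiteness]
  simpa only [ENNReal.toReal_pow, toReal_enorm] using ENNReal.hasSum_toReal hu

theorem tsum_enorm_sq_eq_ofReal {u : ι → ℂ} {a : ℝ} (hu : HasSum (fun i => ‖u i‖ ^ 2) a) :
    ∑' i, ‖u i‖ₑ ^ 2 = ENNReal.ofReal a := by
  rw [← hu.tsum_eq, ENNReal.ofReal_tsum_of_nonneg (fun i => by positivity) hu.summable]
  simp [ENNReal.ofReal_pow]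

/-- The frame inequalities with bounds `A` and `B`, stated in `ℝ≥0∞` so that they entail the
convergence of the sums. -/
structure HasFrameBounds (v : ι → H) (A B : ℝ≥0) : Prop where
  lower : ∀ f : H, A * ‖f‖ₑ ^ 2 ≤ ∑' i, ‖inner ℂ (v i) f‖ₑ ^ 2
  upper : ∀ f : H, ∑' i, ‖inner ℂ (v i) f‖ₑ ^ 2 ≤ B * ‖f‖ₑ ^ 2

theorem isHilbertFrame_iff_exists_hasFrameBounds {v : ι → H} :
    IsHilbertFrame v ↔ ∃ A B : ℝ≥0, 0 < A ∧ A ≤ B ∧ HasFrameBounds v A B := by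
  constructor
  · rintro ⟨A, B, hA, hB, h⟩
    lift A to ℝ≥0 using hA.le
    lift B to ℝ≥0 using hB.le
    refine ⟨min A B, B, lt_min hA hB, min_le_right A B, fun f => ?_, fun f => ?_⟩
    · rw [coe_mul_enorm_sq, tsum_enorm_sq_eq_ofReal (h f).1.hasSum]
      refine ENNReal.ofReal_le_ofReal (le_trans ?_ (h f).2.1)
      gcongr
      exact min_le_left A B
    · rw [coe_mul_enorm_sq, tsum_enorm_sq_eq_ofReal (h f).1.hasSum]
      exact ENNReal.ofReal_le_ofReal (h f).2.2
  · rintro ⟨A, B, hA, hAB, h⟩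
    refine ⟨A, B, hA, hA.trans_le hAB, fun f => ?_⟩
    have hfin : ∑' i, ‖inner ℂ (v i) f‖ₑ ^ 2 ≠ ∞ := ne_top_of_le_ne_top (by finiteness) (h.upper f)
    have hsum := hasSum_norm_sq_toReal hfin
    refine ⟨hsum.summable, ?_, ?_⟩
    · rw [hsum.tsum_eq, ← ENNReal.ofReal_le_iff_le_toReal hfin, ← coe_mul_enorm_sq]
      exact h.lower f
    · rw [hsum.tsum_eq]
      exact ENNReal.toReal_le_of_le_ofReal (by positivity)
        ((h.upper f).trans_eq (coe_mul_enorm_sq B f))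

/-- `S` is the frame operator `f ↦ ∑ i, ⟨f, v i⟩ v i`, in the weak sense. -/
def IsFrameOperator (v : ι → H) (S : H →L[ℂ] H) : Prop :=
  ∀ f h : H, HasSum (fun i => inner ℂ f (v i) * inner ℂ (v i) h) (inner ℂ f (S h))

variable {v : ι → H} {A B : ℝ≥0} {S : H →L[ℂ] H}

theorem HasFrameBounds.exists_analysis (hv : HasFrameBounds v A B) :
    ∃ T : H →L[ℂ] lp (fun _ : ι => ℂ) 2, ∀ f i, T f i = inner ℂ (v i) f := by
  have hfin : ∀ f, ∑' i, ‖inner ℂ (v i) f‖ₑ ^ 2 ≠ ∞ := fun f =>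
    ne_top_of_le_ne_top (by finiteness) (hv.upper f)
  let T : H →ₗ[ℂ] lp (fun _ : ι => ℂ) 2 :=
    { toFun := fun f => ⟨fun i => inner ℂ (v i) f,
        memℓp_gen (by simpa using (hasSum_norm_sq_toReal (hfin f)).summable)⟩
      map_add' := fun f h => by ext i; exact inner_add_right _ _ _
      map_smul' := fun c f => by ext i; exact inner_smul_right _ _ _ }
  refine ⟨T.mkContinuous (Real.sqrt B) fun f => le_of_sq_le_sq ?_ (by positivity), fun f i => rfl⟩
  have hnorm : ‖T f‖ ^ 2 = ∑' i, ‖inner ℂ (v i) f‖ ^ 2 := by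
    simpa [T] using lp.norm_rpow_eq_tsum (p := 2) (by norm_num) (T f)
  rw [hnorm, mul_pow, Real.sq_sqrt B.coe_nonneg, (hasSum_norm_sq_toReal (hfin f)).tsum_eq]
  simpa using ENNReal.toReal_mono (by finiteness) (hv.upper f)

theorem HasFrameBounds.exists_isFrameOperator [CompleteSpace H] (hv : HasFrameBounds v A B) :
    ∃ S : H →L[ℂ] H, IsFrameOperator v S := by
  obtain ⟨T, hT⟩ := hv.exists_analysis
  refine ⟨T.adjoint.comp T, fun f h => ?_⟩
  rw [ContinuousLinearMap.comp_apply, ContinuousLinearMap.adjoint_inner_right]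
  simpa only [hT, RCLike.inner_apply, inner_conj_symm, mul_comm] using
    lp.hasSum_inner (𝕜 := ℂ) (T f) (T h)

theorem le_of_forall_re_inner_le [CompleteSpace H] {X Y : H →L[ℂ] H} (hX : IsSelfAdjoint X)
    (hY : IsSelfAdjoint Y) (h : ∀ f, (inner ℂ f (X f)).re ≤ (inner ℂ f (Y f)).re) : X ≤ Y := by
  rw [ContinuousLinearMap.le_def, ContinuousLinearMap.isPositive_def']
  refine ⟨hY.sub hX, fun f => ?_⟩
  rw [ContinuousLinearMap.reApplyInnerSelf_apply, inner_re_symm, sub_apply, inner_sub_right,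
    map_sub]
  exact sub_nonneg.2 (h f)

theorem re_inner_algebraMap (c : ℝ) (f : H) :
    (inner ℂ f (algebraMap ℝ (H →L[ℂ] H) c f)).re = c * ‖f‖ ^ 2 := by
  rw [Algebra.algebraMap_eq_smul_one, smul_apply, one_apply_eq_self,
    RCLike.real_smul_eq_coe_smul (K := ℂ), inner_smul_right, ← inner_self_eq_norm_sq (𝕜 := ℂ) f]
  exact Complex.re_ofReal_mul _ _

namespace IsFrameOperator

theorem hasSum_norm_sq (hS : IsFrameOperator v S) (f : H) :
    HasSum (fun i => ‖inner ℂ (v i) f‖ ^ 2) (inner ℂ f (S f)).re := by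
  refine (Complex.hasSum_re (hS f f)).congr_fun fun i => ?_
  rw [← inner_conj_symm f (v i), Complex.conj_mul', ← Complex.ofReal_pow, Complex.ofReal_re]

variable [CompleteSpace H]

theorem isSelfAdjoint (hS : IsFrameOperator v S) : IsSelfAdjoint S := by
  rw [ContinuousLinearMap.isSelfAdjoint_iff_isSymmetric]
  exact fun f h => HasSum.unique (by simpa [mul_comm] using (hS h f).star) (hS f h)

theorem algebraMap_le (hS : IsFrameOperator v S) (hv : HasFrameBounds v A B) :
    algebraMap ℝ (H →L[ℂ] H) A ≤ S := by
  refine le_of_forall_re_inner_le (IsSelfAdjoint.algebraMap _ (IsSelfAdjoint.all _))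
    hS.isSelfAdjoint fun f => ?_
  rw [re_inner_algebraMap, ← ENNReal.ofReal_le_ofReal_iff
    ((hS.hasSum_norm_sq f).nonneg fun i => by positivity), ← coe_mul_enorm_sq,
    ← tsum_enorm_sq_eq_ofReal (hS.hasSum_norm_sq f)]
  exact hv.lower f

theorem le_algebraMap (hS : IsFrameOperator v S) (hv : HasFrameBounds v A B) :
    S ≤ algebraMap ℝ (H →L[ℂ] H) B := by
  refine le_of_forall_re_inner_le hS.isSelfAdjoint
    (IsSelfAdjoint.algebraMap _ (IsSelfAdjoint.all _)) fun f => ?_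
  rw [re_inner_algebraMap, ← ENNReal.ofReal_le_ofReal_iff (by positivity), ← coe_mul_enorm_sq,
    ← tsum_enorm_sq_eq_ofReal (hS.hasSum_norm_sq f)]
  exact hv.upper f

theorem norm_one_sub_smul_le (hS : IsFrameOperator v S) (hv : HasFrameBounds v A B)
    (hA : 0 < A) (hAB : A ≤ B) : ‖1 - (B : ℝ)⁻¹ • S‖ ≤ 1 - A / B := by
  have hB : (0 : ℝ) < B := hA.trans_le hAB
  have hscale : ∀ c : ℝ, (B : ℝ)⁻¹ • algebraMap ℝ (H →L[ℂ] H) c = algebraMap ℝ _ (c / B) :=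
    fun c => by rw [div_eq_inv_mul, map_mul, Algebra.smul_def]
  have hupper : (B : ℝ)⁻¹ • S ≤ 1 := by
    simpa [hscale, hB.ne'] using
      smul_le_smul_of_nonneg_left (hS.le_algebraMap hv) (inv_nonneg.2 hB.le)
  have hlower : algebraMap ℝ _ (A / B : ℝ) ≤ (B : ℝ)⁻¹ • S := by
    simpa only [hscale] using smul_le_smul_of_nonneg_left (hS.algebraMap_le hv) (inv_nonneg.2 hB.le)
  have hnonneg : 0 ≤ 1 - (B : ℝ)⁻¹ • S := sub_nonneg.2 hupper
  refine (CStarAlgebra.norm_le_iff_le_algebraMap _ (sub_nonneg.2 ((div_le_one hB).2 hAB))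
    hnonneg).2 ?_
  rw [map_sub, map_one]
  exact sub_le_sub_left hlower 1

/-- The Neumann series for `S⁻¹` stays in every space of operators that contains `1` and is stable
under `X ↦ X * S`. -/
theorem exists_approx_inverse (hS : IsFrameOperator v S) (hv : HasFrameBounds v A B)
    (hA : 0 < A) (hAB : A ≤ B) (P : Submodule ℂ (H →L[ℂ] H)) (h1 : 1 ∈ P)
    (hmul : ∀ X ∈ P, X * S ∈ P) {δ : ℝ} (hδ : 0 < δ) :
    ∃ R ∈ P, IsSelfAdjoint R ∧ ‖1 - R * S‖ ≤ δ := by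
  set X : H →L[ℂ] H := 1 - (B : ℝ)⁻¹ • S with hXdef
  have hX : IsSelfAdjoint X :=
    (IsSelfAdjoint.one _).sub (IsSelfAdjoint.smul (IsSelfAdjoint.all _) hS.isSelfAdjoint)
  have hpow : ∀ k : ℕ, X ^ k ∈ P := fun k => by
    induction k with
    | zero => simpa using h1
    | succ k ih =>
      rw [pow_succ, hXdef, mul_sub, mul_one, mul_smul_comm, ← hXdef]
      exact P.sub_mem ih (P.smul_of_tower_mem _ (hmul _ ih))
  have hnorm : ‖X‖ < 1 := (hS.norm_one_sub_smul_le hv hA hAB).trans_lt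
    (sub_lt_self 1 (div_pos hA (hA.trans_le hAB)))
  obtain ⟨m, hm⟩ := exists_pow_lt_of_lt_one hδ hnorm
  refine ⟨(B : ℝ)⁻¹ • ∑ k ∈ Finset.range (m + 1), X ^ k,
    P.smul_of_tower_mem _ (P.sum_mem fun k _ => hpow k),
    IsSelfAdjoint.smul (IsSelfAdjoint.all _) (isSelfAdjoint_sum _ fun k _ => hX.pow k), ?_⟩
  have hBS : (B : ℝ)⁻¹ • S = 1 - X := by rw [hXdef, sub_sub_cancel]
  rw [smul_mul_assoc, ← mul_smul_comm, hBS, geom_sum_mul_neg, sub_sub_cancel]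
  exact (norm_pow_le' X m.succ_pos).trans
    ((pow_le_pow_of_le_one (norm_nonneg X) hnorm.le m.le_succ).trans hm.le)

end IsFrameOperator

end Frame

/-! ### Removal of frame elements -/

section Schur

variable {ι κ : Type*}

theorem two_mul_mul_le_enn_sq_add_sq (a b : ℝ≥0∞) : 2 * (a * b) ≤ a ^ 2 + b ^ 2 := by
  wlog h : a ≤ b generalizing a b
  · rw [mul_comm a b, add_comm]
    exact this b a (le_of_not_ge h)
  obtain ⟨t, rfl⟩ := exists_add_of_le h
  calc 2 * (a * (a + t)) ≤ 2 * (a * (a + t)) + t ^ 2 := le_self_add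
    _ = a ^ 2 + (a + t) ^ 2 := by ring

/-- Expand both squares as double sums and use `2 c i c j ≤ c i ^ 2 + c j ^ 2`. -/
theorem sq_tsum_mul_le (k c : ι → ℝ≥0∞) :
    (∑' i, k i * c i) ^ 2 ≤ (∑' i, k i) * ∑' i, k i * c i ^ 2 := by
  have hexpand : ∑' i, ∑' j, k i * k j * (c i ^ 2 + c j ^ 2)
      = 2 * ((∑' i, k i) * ∑' i, k i * c i ^ 2) := by
    simp_rw [mul_add, ENNReal.tsum_add]
    rw [two_mul]
    congr 1
    · simp_rw [mul_right_comm _ _ (c _ ^ 2), ENNReal.tsum_mul_left, ENNReal.tsum_mul_right]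
      rw [mul_comm]
    · simp_rw [mul_assoc, ENNReal.tsum_mul_left, ENNReal.tsum_mul_right]
  refine (ENNReal.mul_le_mul_iff_right two_ne_zero ENNReal.ofNat_ne_top).1 ?_
  rw [← hexpand, pow_two, ← ENNReal.tsum_mul_right, ← ENNReal.tsum_mul_left]
  refine ENNReal.tsum_le_tsum fun i => ?_
  rw [← ENNReal.tsum_mul_left, ← ENNReal.tsum_mul_left]
  refine ENNReal.tsum_le_tsum fun j => ?_
  calc 2 * (k i * c i * (k j * c j)) = k i * k j * (2 * (c i * c j)) := by ring
    _ ≤ k i * k j * (c i ^ 2 + c j ^ 2) := by gcongr; exact two_mul_mul_le_enn_sq_add_sq _ _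

theorem add_add_sq_le (p q r : ℝ≥0∞) : (p + q + r) ^ 2 ≤ 3 * (p ^ 2 + q ^ 2 + r ^ 2) := by
  simpa [tsum_fintype, Fin.sum_univ_three] using sq_tsum_mul_le (fun _ : Fin 3 => 1) ![p, q, r]

theorem schur_test (k : ι → κ → ℝ≥0∞) (c : κ → ℝ≥0∞) {r s : ℝ≥0∞}
    (hr : ∀ i, ∑' j, k i j ≤ r) (hs : ∀ j, ∑' i, k i j ≤ s) :
    ∑' i, (∑' j, k i j * c j) ^ 2 ≤ r * s * ∑' j, c j ^ 2 := by
  calc ∑' i, (∑' j, k i j * c j) ^ 2 ≤ ∑' i, r * ∑' j, k i j * c j ^ 2 := by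
        refine ENNReal.tsum_le_tsum fun i => (sq_tsum_mul_le _ _).trans ?_
        gcongr
        exact hr i
    _ = r * ∑' j, (∑' i, k i j) * c j ^ 2 := by
        rw [ENNReal.tsum_mul_left, ENNReal.tsum_comm]
        simp_rw [ENNReal.tsum_mul_right]
    _ ≤ r * ∑' j, s * c j ^ 2 := by gcongr with j; exact hs j
    _ = r * s * ∑' j, c j ^ 2 := by rw [ENNReal.tsum_mul_left, mul_assoc]

theorem sq_mul_tsum_sq_le_of_forall_mul_le {k : ι → ι → ℝ≥0∞} {k' : ι → κ → ℝ≥0∞}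
    {x e : ι → ℝ≥0∞} {y : κ → ℝ≥0∞} {γ ε M : ℝ≥0∞}
    (hx : ∀ i, γ * x i ≤ ∑' j, k i j * x j + ∑' j, k' i j * y j + e i)
    (hksymm : ∀ i j, k i j = k j i) (hk : ∀ i, ∑' j, k i j ≤ ε)
    (hrow : ∀ i, ∑' j, k' i j ≤ M) (hcol : ∀ j, ∑' i, k' i j ≤ M) :
    γ ^ 2 * ∑' i, x i ^ 2
      ≤ 3 * (ε ^ 2 * ∑' i, x i ^ 2 + M ^ 2 * ∑' j, y j ^ 2 + ∑' i, e i ^ 2) := by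
  calc γ ^ 2 * ∑' i, x i ^ 2 = ∑' i, (γ * x i) ^ 2 := by
        simp_rw [mul_pow, ENNReal.tsum_mul_left]
    _ ≤ ∑' i, 3 * ((∑' j, k i j * x j) ^ 2 + (∑' j, k' i j * y j) ^ 2 + e i ^ 2) :=
        ENNReal.tsum_le_tsum fun i => (pow_le_pow_left' (hx i) 2).trans (add_add_sq_le _ _ _)
    _ ≤ _ := by
        rw [ENNReal.tsum_mul_left, ENNReal.tsum_add, ENNReal.tsum_add, pow_two ε, pow_two M]
        gcongr
        · exact schur_test k x hk fun j => by simpa only [hksymm _ j] using hk j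
        · exact schur_test k' y hrow hcol

end Schur

section Removal

variable {ι : Type*} {H : Type*} [NormedAddCommGroup H] [InnerProductSpace ℂ H]
  {v : ι → H} {S R : H →L[ℂ] H} {A B : ℝ≥0}

theorem HasFrameBounds.tsum_enorm_sq_apply_le (hv : HasFrameBounds v A B) (hA : 0 < A)
    {T : H →L[ℂ] H} {δ : ℝ≥0} (hT : ‖T‖ ≤ δ) (f : H) :
    ∑' i, ‖inner ℂ (v i) (T f)‖ₑ ^ 2 ≤ (B / A * δ ^ 2 : ℝ≥0) * ∑' i, ‖inner ℂ (v i) f‖ₑ ^ 2 := by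
  have hTf : ‖T f‖ₑ ≤ δ * ‖f‖ₑ := by
    refine (T.le_opENorm f).trans ?_
    gcongr
    exact enorm_le_coe.2 (NNReal.coe_le_coe.1 hT)
  calc ∑' i, ‖inner ℂ (v i) (T f)‖ₑ ^ 2 ≤ B * (δ * ‖f‖ₑ) ^ 2 := (hv.upper _).trans (by gcongr)
    _ = (B / A * δ ^ 2 : ℝ≥0) * (A * ‖f‖ₑ ^ 2) := by
        rw [mul_pow, ← mul_assoc, ← mul_assoc]
        norm_cast
        congr 2
        field_simp
    _ ≤ _ := by gcongr; exact hv.lower f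

variable [CompleteSpace H]

theorem enorm_inner_apply_comm (hR : IsSelfAdjoint R) (f h : H) :
    ‖inner ℂ f (R h)‖ₑ = ‖inner ℂ h (R f)‖ₑ := by
  have hfh : inner ℂ (R f) h = inner ℂ f (R h) :=
    ContinuousLinearMap.isSelfAdjoint_iff_isSymmetric.1 hR f h
  rw [← ofReal_norm, ← ofReal_norm, ← hfh, norm_inner_symm]

/-- Expand `R S f` in `⟨v i, f⟩ = ⟨v i, R S f⟩ + ⟨v i, (1 - R S) f⟩` by the frame operator and move
the `i`-th term to the left. -/
theorem IsFrameOperator.mul_enorm_inner_le [DecidableEq ι] (hS : IsFrameOperator v S)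
    (hR : IsSelfAdjoint R) {γ : ℝ≥0} {i : ι} (hi : (inner ℂ (v i) (R (v i))).re ≤ 1 - γ) (f : H) :
    γ * ‖inner ℂ (v i) f‖ₑ
      ≤ ∑' j, (if j = i then 0 else ‖inner ℂ (v i) (R (v j))‖ₑ) * ‖inner ℂ (v j) f‖ₑ
        + ‖inner ℂ (v i) ((1 - R * S) f)‖ₑ := by
  have hRsymm : ∀ a b : H, inner ℂ (R a) b = inner ℂ a (R b) :=
    ContinuousLinearMap.isSelfAdjoint_iff_isSymmetric.1 hR
  let w : ι → ℂ := fun j => inner ℂ (v i) (R (v j)) * inner ℂ (v j) f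
  have hsum : HasSum w (inner ℂ (v i) (R (S f))) := by
    simpa only [hRsymm] using hS (R (v i)) f
  have hsplit : HasSum (fun j => if j = i then 0 else w j) (inner ℂ (v i) (R (S f)) - w i) := by
    refine (hsum.sub (hasSum_ite_eq i (w i))).congr_fun fun j => ?_
    by_cases hj : j = i <;> simp [hj]
  have hdec : (1 - inner ℂ (v i) (R (v i))) * inner ℂ (v i) f
      = (∑' j, if j = i then 0 else w j) + inner ℂ (v i) ((1 - R * S) f) := by
    rw [hsplit.tsum_eq, sub_apply, one_apply_eq_self, inner_sub_right,
      ContinuousLinearMap.mul_def, ContinuousLinearMap.comp_apply]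
    ring
  calc γ * ‖inner ℂ (v i) f‖ₑ
      ≤ ‖(1 - inner ℂ (v i) (R (v i))) * inner ℂ (v i) f‖ₑ := by
        rw [enorm_mul, ← ofReal_norm (1 - _), ← ENNReal.ofReal_coe_nnreal]
        gcongr
        refine le_trans ?_ (Complex.re_le_norm _)
        rw [Complex.sub_re, Complex.one_re]
        linarith
    _ ≤ ‖∑' j, if j = i then 0 else w j‖ₑ + ‖inner ℂ (v i) ((1 - R * S) f)‖ₑ :=
        hdec ▸ enorm_add_le _ _
    _ ≤ _ := by
        gcongr
        refine enorm_tsum_le_tsum_enorm.trans (ENNReal.tsum_le_tsum fun j => ?_)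
        split_ifs <;> simp [w, enorm_mul]

theorem IsFrameOperator.sq_mul_tsum_enorm_sq_le [DecidableEq ι] (hS : IsFrameOperator v S)
    (hv : HasFrameBounds v A B) (hA : 0 < A) (hR : IsSelfAdjoint R) {γ ε δ M : ℝ≥0} {J : Set ι}
    (hdiag : ∀ i ∈ J, (inner ℂ (v i) (R (v i))).re ≤ 1 - γ)
    (hoff : ∀ i : J, ∑' j : J, (if j = i then 0 else ‖inner ℂ (v i) (R (v j))‖ₑ) ≤ ε)
    (hrow : ∀ i, ∑' j, ‖inner ℂ (v i) (R (v j))‖ₑ ≤ M)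
    (hδ : ‖1 - R * S‖ ≤ δ) (hsmall : 6 * (ε ^ 2 + B / A * δ ^ 2) ≤ γ ^ 2) (f : H) :
    (γ : ℝ≥0∞) ^ 2 * ∑' i : J, ‖inner ℂ (v i) f‖ₑ ^ 2
      ≤ 6 * (M ^ 2 + B / A * δ ^ 2 : ℝ≥0) * ∑' i : ↥Jᶜ, ‖inner ℂ (v i) f‖ₑ ^ 2 := by
  let X := ∑' i : J, ‖inner ℂ (v i) f‖ₑ ^ 2
  let Y := ∑' i : ↥Jᶜ, ‖inner ℂ (v i) f‖ₑ ^ 2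
  let η : ℝ≥0 := B / A * δ ^ 2
  have hXY : X + Y = ∑' i, ‖inner ℂ (v i) f‖ₑ ^ 2 :=
    ENNReal.summable.tsum_add_tsum_compl (f := fun i => ‖inner ℂ (v i) f‖ₑ ^ 2) (s := J)
      ENNReal.summable
  have hpoint : ∀ i : J, γ * ‖inner ℂ (v i) f‖ₑ
      ≤ ∑' j : J, (if j = i then 0 else ‖inner ℂ (v i) (R (v j))‖ₑ) * ‖inner ℂ (v j) f‖ₑ
        + ∑' j : ↥Jᶜ, ‖inner ℂ (v i) (R (v j))‖ₑ * ‖inner ℂ (v j) f‖ₑ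
        + ‖inner ℂ (v i) ((1 - R * S) f)‖ₑ := fun i => by
    refine (hS.mul_enorm_inner_le hR (hdiag i i.2) f).trans_eq ?_
    rw [← ENNReal.summable.tsum_add_tsum_compl (s := J) ENNReal.summable]
    congr 3 with j
    · simp only [Subtype.ext_iff]
    · rw [if_neg fun hji : (j : ι) = i => j.2 (hji ▸ i.2)]
  have hX : (γ : ℝ≥0∞) ^ 2 * X ≤ 3 * (ε ^ 2 * X + M ^ 2 * Y + η * (X + Y)) := by
    refine (sq_mul_tsum_sq_le_of_forall_mul_le hpoint
      (fun i j => by simp only [eq_comm, enorm_inner_apply_comm hR (v i)]) hoff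
      (fun i => (ENNReal.tsum_comp_le_tsum_of_injective Subtype.val_injective _).trans (hrow i))
      fun j => ?_).trans ?_
    · simp_rw [enorm_inner_apply_comm hR _ (v j)]
      exact (ENNReal.tsum_comp_le_tsum_of_injective Subtype.val_injective _).trans (hrow j)
    · gcongr
      rw [hXY]
      exact (ENNReal.tsum_comp_le_tsum_of_injective Subtype.val_injective _).trans
        (hv.tsum_enorm_sq_apply_le hA hδ f)
  have hfin : (γ : ℝ≥0∞) ^ 2 * X ≠ ∞ := by
    refine ENNReal.mul_ne_top (by finiteness) (ne_top_of_le_ne_top ?_ (le_self_add.trans_eq hXY))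
    exact ne_top_of_le_ne_top (by finiteness) (hv.upper f)
  refine (ENNReal.add_le_add_iff_left hfin).1 ?_
  calc γ ^ 2 * X + γ ^ 2 * X ≤ 2 * (3 * (ε ^ 2 * X + M ^ 2 * Y + η * (X + Y))) := by
        rw [← two_mul]
        gcongr
    _ = (6 * (ε ^ 2 + η) : ℝ≥0) * X + 6 * (M ^ 2 + η : ℝ≥0) * Y := by
        push_cast
        ring
    _ ≤ γ ^ 2 * X + 6 * (M ^ 2 + η : ℝ≥0) * Y := by
        gcongr
        exact_mod_cast hsmall

theorem IsFrameOperator.isHilbertFrame_compl [DecidableEq ι] (hS : IsFrameOperator v S)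
    (hv : HasFrameBounds v A B) (hA : 0 < A) (hAB : A ≤ B) (hR : IsSelfAdjoint R)
    {γ ε δ M : ℝ≥0} (hγ : 0 < γ) {J : Set ι}
    (hdiag : ∀ i ∈ J, (inner ℂ (v i) (R (v i))).re ≤ 1 - γ)
    (hoff : ∀ i : J, ∑' j : J, (if j = i then 0 else ‖inner ℂ (v i) (R (v j))‖ₑ) ≤ ε)
    (hrow : ∀ i, ∑' j, ‖inner ℂ (v i) (R (v j))‖ₑ ≤ M)
    (hδ : ‖1 - R * S‖ ≤ δ) (hsmall : 6 * (ε ^ 2 + B / A * δ ^ 2) ≤ γ ^ 2) :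
    IsHilbertFrame (fun i : ↥Jᶜ => v i) := by
  let L : ℝ≥0 := 6 * (M ^ 2 + B / A * δ ^ 2)
  have hγL : 0 < γ ^ 2 + L := by positivity
  refine isHilbertFrame_iff_exists_hasFrameBounds.2
    ⟨γ ^ 2 * A / (γ ^ 2 + L), B, by positivity, ?_, fun f => ?_, fun f => ?_⟩
  · refine (div_le_iff₀ hγL).2 ?_
    calc γ ^ 2 * A ≤ γ ^ 2 * B := by gcongr
      _ ≤ B * (γ ^ 2 + L) := by
        rw [mul_comm]
        gcongr
        exact le_self_add
  · let X := ∑' i : J, ‖inner ℂ (v i) f‖ₑ ^ 2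
    let Y := ∑' i : ↥Jᶜ, ‖inner ℂ (v i) f‖ₑ ^ 2
    have hXY : X + Y = ∑' i, ‖inner ℂ (v i) f‖ₑ ^ 2 :=
      ENNReal.summable.tsum_add_tsum_compl (f := fun i => ‖inner ℂ (v i) f‖ₑ ^ 2) (s := J)
        ENNReal.summable
    have hX : (γ : ℝ≥0∞) ^ 2 * X ≤ L * Y :=
      hS.sq_mul_tsum_enorm_sq_le hv hA hR hdiag hoff hrow hδ hsmall f
    have hAf : ((γ ^ 2 * A : ℝ≥0) : ℝ≥0∞) * ‖f‖ₑ ^ 2 ≤ (γ ^ 2 + L : ℝ≥0) * Y :=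
      calc ((γ ^ 2 * A : ℝ≥0) : ℝ≥0∞) * ‖f‖ₑ ^ 2 = γ ^ 2 * (A * ‖f‖ₑ ^ 2) := by
            push_cast
            ring
        _ ≤ γ ^ 2 * X + γ ^ 2 * Y := by
            rw [← mul_add, hXY]
            gcongr
            exact hv.lower f
        _ ≤ L * Y + γ ^ 2 * Y := by gcongr
        _ = (γ ^ 2 + L : ℝ≥0) * Y := by
            push_cast
            ring
    calc ((γ ^ 2 * A / (γ ^ 2 + L) : ℝ≥0) : ℝ≥0∞) * ‖f‖ₑ ^ 2
        = ((γ ^ 2 * A : ℝ≥0) : ℝ≥0∞) * ‖f‖ₑ ^ 2 / (γ ^ 2 + L : ℝ≥0) := by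
          rw [ENNReal.coe_div hγL.ne', ENNReal.mul_div_right_comm]
      _ ≤ Y := ENNReal.div_le_of_le_mul' hAf
  · exact (ENNReal.tsum_comp_le_tsum_of_injective Subtype.val_injective _).trans (hv.upper f)

end Removal

/-! ### Operators localized with respect to an orbit -/

namespace ProjUnitaryRep

section LocalizedOperators

variable {G : Type*} [Group G] [MeasurableSpace G]
  {H : Type*} [NormedAddCommGroup H] [InnerProductSpace ℂ H]

/-- The absolute values `|⟨π y g, X π z g⟩|` of the matrix coefficients of an operator `X` with
respect to the orbit of `g`. -/
noncomputable def absMatrix (π : ProjUnitaryRep G H) (g : H) (X : H →L[ℂ] H) (y z : G) : ℝ≥0∞ :=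
  ‖inner ℂ (π y g) (X (π z g))‖ₑ

variable (π : ProjUnitaryRep G H) {g : H}

theorem absMatrix_one (y z : G) : π.absMatrix g 1 y z = ‖π.coeff g g (y⁻¹ * z)‖ₑ := by
  rw [absMatrix, one_apply_eq_self, ← ofReal_norm, ← ofReal_norm, norm_inner_map_map, coeff,
    norm_inner_symm]

variable [TopologicalSpace G]

/-- The operators whose matrix with respect to `(π l g)_{l ∈ Λ}` is localized near the diagonal. -/
def localizedOps (g : H) (Λ : Set G) : Submodule ℂ (H →L[ℂ] H) where
  carrier := {X | IsLocalizedKernel Λ Λ (π.absMatrix g X)}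
  zero_mem' := ⟨⟨0, by simp [absMatrix]⟩, fun ε _ => ⟨∅, isCompact_empty, by simp [absMatrix]⟩⟩
  add_mem' hX hY := (hX.add hY).mono subset_rfl fun y _ z _ => by
    simpa only [Pi.add_apply, absMatrix, add_apply, inner_add_right] using enorm_add_le _ _
  smul_mem' c X hX := (hX.const_mul ‖c‖₊).mono subset_rfl fun y _ z _ => by
    rw [absMatrix, smul_apply, inner_smul_right, enorm_mul]
    rfl

variable {π} {Λ : Set G}

theorem mul_mem_localizedOps [IsTopologicalGroup G] [CompleteSpace H] {X S : H →L[ℂ] H}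
    (h1 : 1 ∈ π.localizedOps g Λ) (hS : IsFrameOperator (fun l : Λ => π (l : G) g) S)
    (hX : X ∈ π.localizedOps g Λ) : X * S ∈ π.localizedOps g Λ := by
  refine IsLocalizedKernel.mono (hX.comp h1) subset_rfl fun y _ z _ => ?_
  have hsum := hS (X.adjoint (π y g)) (π z g)
  simp only [ContinuousLinearMap.adjoint_inner_left] at hsum
  rw [absMatrix, ContinuousLinearMap.mul_def, ContinuousLinearMap.comp_apply, ← hsum.tsum_eq]
  simpa only [absMatrix, one_apply_eq_self, ← enorm_mul] using enorm_tsum_le_tsum_enorm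

variable [IsTopologicalGroup G] [LocallyCompactSpace G] [SecondCountableTopology G]
  [BorelSpace G] {μ : Measure G} [μ.IsHaarMeasure] {Q : Set G} {N : ℕ}

theorem lintegral_enorm_coeff_ne_top (hg : g ∈ π.B1 μ Q) (hQs : Q⁻¹ = Q)
    (hQ1 : Q ∈ 𝓝 (1 : G)) : ∫⁻ x, ‖π.coeff g g x‖ₑ ∂μ ≠ ∞ := by
  refine ne_top_of_le_ne_top hg.lintegral_lt_top.ne (lintegral_mono fun x => ?_)
  simpa using π.enorm_coeff_le_localMaximal μ hQs g g x (mem_interior_iff_mem_nhds.2 hQ1)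

variable [T2Space G]

theorem isLocalizedKernel_enorm_coeff (hg : g ∈ π.B1 μ Q) (hΛ : IsRelativelySeparated Q N Λ)
    (hQc : IsCompact Q) (hQs : Q⁻¹ = Q) (hQ1 : Q ∈ 𝓝 (1 : G)) :
    IsLocalizedKernel Set.univ Λ (fun y z => ‖π.coeff g g (y⁻¹ * z)‖ₑ) :=
  hΛ.isLocalizedKernel (φ := fun w => ‖π.coeff g g w‖ₑ) hQc hQs hQ1 hg.aemeasurable
    hg.lintegral_lt_top.ne fun w _ hz => π.enorm_coeff_le_localMaximal μ hQs g g w hz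

theorem one_mem_localizedOps (hg : g ∈ π.B1 μ Q) (hΛ : IsRelativelySeparated Q N Λ)
    (hQc : IsCompact Q) (hQs : Q⁻¹ = Q) (hQ1 : Q ∈ 𝓝 (1 : G)) : 1 ∈ π.localizedOps g Λ :=
  (isLocalizedKernel_enorm_coeff hg hΛ hQc hQs hQ1).mono (Set.subset_univ _)
    fun y _ z _ => (π.absMatrix_one y z).le

end LocalizedOperators

end ProjUnitaryRep

/-! ### Interaction across the boundary of Følner sets -/

section Boundary

variable {G : Type*}

open Classical in
/-- The part of the row sum `∑_{l ∈ Λ} k y l` over those `l` which the set `E` separates from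
`y`. -/
noncomputable def crossSum (Λ E : Set G) (k : G → G → ℝ≥0∞) (y : G) : ℝ≥0∞ :=
  ∑' l : Λ, if (y ∈ E ↔ (l : G) ∈ E) then 0 else k y l

theorem crossSum_le_mul {Λ E : Set G} {k k' : G → G → ℝ≥0∞} {y : G} {c : ℝ≥0∞}
    (h : ∀ l ∈ Λ, k y l ≤ c * k' y l) : crossSum Λ E k y ≤ c * crossSum Λ E k' y := by
  classical
  rw [crossSum, crossSum, ← ENNReal.tsum_mul_left]
  refine ENNReal.tsum_le_tsum fun l => ?_
  split_ifs
  · exact zero_le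
  · exact h l l.2

/-- If `y ∈ E`, compare the partial sum over `E` with the whole series; if `y ∉ E`, every term of
the partial sum crosses the boundary. -/
theorem enorm_sum_le_indicator_add_crossSum {Λ E : Set G} {w : G → ℂ} {s : ℂ}
    (hw : HasSum (fun l : Λ => w l) s) {F : Finset Λ} (hF : ∀ l : Λ, l ∈ F ↔ (l : G) ∈ E) (y : G) :
    ‖∑ l ∈ F, w l‖ₑ ≤ E.indicator (fun _ => ‖s‖ₑ) y + crossSum Λ E (fun _ l => ‖w l‖ₑ) y := by
  classical
  by_cases hy : y ∈ E
  · have hrest := F.hasSum_iff_compl.1 hw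
    rw [Set.indicator_of_mem hy, ← sub_sub_cancel s (∑ l ∈ F, w l)]
    refine enorm_sub_le.trans (add_le_add le_rfl ?_)
    rw [← hrest.tsum_eq]
    refine enorm_tsum_le_tsum_enorm.trans ?_
    refine le_trans (ENNReal.tsum_le_tsum fun l => ?_)
      (ENNReal.tsum_comp_le_tsum_of_injective Subtype.val_injective _)
    simp [hy, ← hF, l.2]
  · rw [Set.indicator_of_notMem hy, zero_add]
    refine (enorm_sum_le _ _).trans (le_trans (Finset.sum_le_sum fun l hl => ?_)
      (ENNReal.sum_le_tsum F))
    simp [hy, (hF l).1 hl]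

variable [Group G]

theorem mem_mul_inter_compl_mul {E D : Set G} {y l : G} (hD1 : 1 ∈ D) (hyl : l⁻¹ * y ∈ D)
    (hE : ¬(y ∈ E ↔ l ∈ E)) : y ∈ (E * D) ∩ (Eᶜ * D) := by
  have hy : ∀ s : Set G, y ∈ s → y ∈ s * D := fun s h => ⟨y, h, 1, hD1, mul_one y⟩
  have hl : ∀ s : Set G, l ∈ s → y ∈ s * D := fun s h => ⟨l, h, _, hyl, mul_inv_cancel_left l y⟩
  by_cases hyE : y ∈ E
  · exact ⟨hy E hyE, hl Eᶜ fun h => hE (iff_of_true hyE h)⟩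
  · exact ⟨hl E (not_not.1 fun h => hE (iff_of_false hyE h)), hy Eᶜ hyE⟩

/-- Near the boundary of `E` bound the whole row sum; elsewhere only pairs with `l ∉ y • C`
contribute. -/
theorem crossSum_le {Λ E C D : Set G} {k : G → G → ℝ≥0∞} {y : G} {M ε : ℝ≥0∞}
    (hM : ∑' l : Λ, k y l ≤ M) (hε : ∑' l : Λ, (y • C)ᶜ.indicator (k y) (l : G) ≤ ε)
    (hD1 : 1 ∈ D) (hCD : C⁻¹ ⊆ D) :
    crossSum Λ E k y ≤ ((E * D) ∩ (Eᶜ * D)).indicator (fun _ => M) y + E.indicator (fun _ => ε) y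
      + ∑' l : Λ, E.indicator 1 (l : G) * (y • C)ᶜ.indicator (k y) (l : G) := by
  classical
  by_cases hyT : y ∈ (E * D) ∩ (Eᶜ * D)
  · rw [Set.indicator_of_mem hyT, add_assoc]
    refine le_trans (ENNReal.tsum_le_tsum fun l => ?_) (hM.trans le_self_add)
    split_ifs <;> simp
  have hfar : ∀ l, ¬(y ∈ E ↔ l ∈ E) → l ∈ (y • C)ᶜ := fun l hl hly =>
    hyT <| mem_mul_inter_compl_mul hD1 (hCD <| by
      simpa [Set.mem_smul_set_iff_inv_smul_mem] using hly) hl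
  by_cases hy : y ∈ E
  · rw [Set.indicator_of_mem hy, add_assoc]
    refine le_trans (ENNReal.tsum_le_tsum fun l => ?_)
      (hε.trans (le_self_add.trans le_add_self))
    split_ifs with hl
    · simp
    · rw [Set.indicator_of_mem (hfar l hl)]
  · refine le_trans (ENNReal.tsum_le_tsum fun l => ?_) le_add_self
    split_ifs with hl
    · simp
    · rw [Set.indicator_of_mem (hfar l hl),
        Set.indicator_of_mem (not_not.1 fun h => hl (iff_of_false hy h)), Pi.one_apply, one_mul]

theorem lintegral_comp_inv_mul [MeasurableSpace G] [MeasurableMul G] [MeasurableInv G]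
    (μ : Measure G) [μ.IsMulLeftInvariant] [μ.IsInvInvariant] (φ : G → ℝ≥0∞) (l : G) :
    ∫⁻ y, φ (y⁻¹ * l) ∂μ = ∫⁻ y, φ y ∂μ := by
  rw [← lintegral_mul_left_eq_self _ l, ← lintegral_inv_eq_self (f := φ)]
  simp only [mul_inv_rev, inv_mul_cancel_right]

variable [TopologicalSpace G] [IsTopologicalGroup G] [MeasurableSpace G] [BorelSpace G]
  {μ : Measure G} {Λ : Set G} {φ : G → ℝ≥0∞}

theorem lintegral_crossSum_le [μ.IsMulLeftInvariant] [μ.IsInvInvariant] (hΛ : Λ.Countable)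
    (hφ : Measurable φ) {E C D : Set G} {M ε : ℝ≥0∞}
    (hM : ∀ y, ∑' l : Λ, φ (y⁻¹ * l) ≤ M)
    (hε : ∀ y, ∑' l : Λ, (y • C)ᶜ.indicator (fun z => φ (y⁻¹ * z)) (l : G) ≤ ε)
    (hE : MeasurableSet E) (hC : MeasurableSet C) (hD1 : 1 ∈ D) (hCD : C⁻¹ ⊆ D) :
    ∫⁻ y, crossSum Λ E (fun y l => φ (y⁻¹ * l)) y ∂μ
      ≤ M * μ ((E * D) ∩ (Eᶜ * D)) + ε * μ E + (Λ ∩ E).encard * ∫⁻ z in Cᶜ, φ z ∂μ := by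
  have : Countable Λ := hΛ.to_subtype
  let ψ : G → ℝ≥0∞ := Cᶜ.indicator φ
  have hψ : ∀ l : G, Measurable fun y => ψ (y⁻¹ * l) := fun l =>
    (hφ.indicator hC.compl).comp (measurable_inv.mul_const l)
  have hterm : ∀ l : G, Measurable fun y => E.indicator (1 : G → ℝ≥0∞) l * ψ (y⁻¹ * l) :=
    fun l => (hψ l).const_mul _
  have hψ_eq : ∀ y l : G, (y • C)ᶜ.indicator (fun z => φ (y⁻¹ * z)) l = ψ (y⁻¹ * l) := fun y l => by
    by_cases h : y⁻¹ * l ∈ C <;> simp [ψ, Set.mem_smul_set_iff_inv_smul_mem, h]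
  calc ∫⁻ y, crossSum Λ E (fun y l => φ (y⁻¹ * l)) y ∂μ
      ≤ ∫⁻ y, ((E * D) ∩ (Eᶜ * D)).indicator (fun _ => M) y + E.indicator (fun _ => ε) y
          + ∑' l : Λ, E.indicator 1 (l : G) * ψ (y⁻¹ * l) ∂μ := by
        refine lintegral_mono fun y => (crossSum_le (hM y) (hε y) hD1 hCD).trans_eq ?_
        simp only [hψ_eq]
    _ = ∫⁻ y, ((E * D) ∩ (Eᶜ * D)).indicator (fun _ => M) y ∂μ + ε * μ E
          + (Λ ∩ E).encard * ∫⁻ z in Cᶜ, φ z ∂μ := by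
        rw [lintegral_add_right _ (Measurable.tsum fun l : Λ => hterm l),
          lintegral_add_right _ (measurable_const.indicator hE),
          lintegral_indicator_const hE, lintegral_tsum fun l : Λ => (hterm l).aemeasurable,
          encard_inter_eq_tsum_indicator, ← ENNReal.tsum_mul_right, ← lintegral_indicator hC.compl]
        simp_rw [lintegral_const_mul _ (hψ _), lintegral_comp_inv_mul μ ψ]
        rfl
    _ ≤ _ := by
        gcongr
        exact lintegral_indicator_const_le _ _

/-- Choose `C` so that the rows of the kernel and `φ` itself are small off `C`; the region within
`C` of the boundary is negligible by the strong Følner condition. -/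
theorem IsStrongFolnerSeq.eventually_lintegral_crossSum_le [LocallyCompactSpace G]
    [SecondCountableTopology G] [T2Space G] [μ.IsHaarMeasure] [μ.IsInvInvariant] {K : ℕ → Set G}
    (hK : IsStrongFolnerSeq μ K) {Q : Set G} {N : ℕ} (hΛ : IsRelativelySeparated Q N Λ)
    (hQc : IsCompact Q) (hQs : Q⁻¹ = Q) (hQ1 : Q ∈ 𝓝 (1 : G)) (hφ : Measurable φ)
    (hφint : ∫⁻ x, φ x ∂μ ≠ ∞)
    (hloc : IsLocalizedKernel Set.univ Λ (fun y z => φ (y⁻¹ * z))) {ε : ℝ≥0∞} (hε : ε ≠ 0) :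
    ∀ᶠ n in atTop, ∀ x : G,
      ∫⁻ y, crossSum Λ (x • K n) (fun y l => φ (y⁻¹ * l)) y ∂μ ≤ ε * μ (K n) := by
  have hQ0 : μ Q ≠ 0 := (Measure.measure_pos_of_mem_nhds μ hQ1).ne'
  have hε3 : ε / 3 ≠ 0 := ENNReal.div_ne_zero.2 ⟨hε, by finiteness⟩
  obtain ⟨M, hM⟩ := hloc.exists_row_bound
  obtain ⟨δ, hδ, hMδ⟩ := exists_ne_zero_mul_le M hε3
  let P : ℝ≥0∞ := N * 2 / μ Q
  have hP : P ≠ ∞ := ENNReal.div_ne_top (by finiteness) hQ0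
  obtain ⟨δ', hδ', hPδ'⟩ := exists_ne_zero_mul_le P.toNNReal hε3
  rw [ENNReal.coe_toNNReal hP] at hPδ'
  obtain ⟨C₁, hC₁, htail⟩ := hloc.exists_tail_bound (ε / 3) hε3
  obtain ⟨C₂, hC₂, hint⟩ := exists_isCompact_setLIntegral_compl_le μ hφint hδ'
  have hC : IsCompact (C₁ ∪ C₂) := hC₁.union hC₂
  let D : Set G := (C₁ ∪ C₂)⁻¹ ∪ {1}
  have hbd := (hK.tendsto_boundary D (hC.inv.union isCompact_singleton)).eventually_le_const
    (pos_iff_ne_zero.2 hδ)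
  filter_upwards [hbd, hΛ.eventually_encard_inter_smul_le hQc hQs hQ1 hK.toIsFolnerSeq]
    with n hn hcard x
  rw [ENNReal.div_le_iff (hK.measure_ne_zero n) (hK.isCompact n).measure_ne_top] at hn
  have htail' : ∀ y, ∑' l : Λ, (y • (C₁ ∪ C₂))ᶜ.indicator (fun z => φ (y⁻¹ * z)) (l : G) ≤ ε / 3 :=
    fun y => (ENNReal.tsum_le_tsum fun l => Set.indicator_le_indicator_of_subset
      (Set.compl_subset_compl.2 (Set.smul_set_mono Set.subset_union_left)) (by simp) _).trans
      (htail y trivial)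
  have hboundary : (x • K n * D) ∩ ((x • K n)ᶜ * D) = x • ((K n * D) ∩ ((K n)ᶜ * D)) := by
    rw [← Set.smul_set_compl, smul_mul_assoc, smul_mul_assoc, Set.smul_set_inter]
  calc _ ≤ M * μ (x • ((K n * D) ∩ ((K n)ᶜ * D))) + ε / 3 * μ (x • K n)
          + (Λ ∩ x • K n).encard * ∫⁻ z in (C₁ ∪ C₂)ᶜ, φ z ∂μ :=
        hboundary ▸ lintegral_crossSum_le (hΛ.countable hQ1) hφ (fun y => hM y trivial) htail'
          ((hK.isCompact n).isClosed.measurableSet.const_smul x) hC.isClosed.measurableSet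
          (.inr rfl) Set.subset_union_left
    _ ≤ M * (δ * μ (K n)) + ε / 3 * μ (K n) + P * μ (K n) * δ' := by
        rw [measure_smul, measure_smul]
        gcongr
        · exact hcard x
        · exact (lintegral_mono_set (Set.compl_subset_compl.2 Set.subset_union_right)).trans hint
    _ = (M * δ + ε / 3 + P * δ') * μ (K n) := by ring
    _ ≤ (ε / 3 + ε / 3 + ε / 3) * μ (K n) := by gcongr
    _ = ε * μ (K n) := by rw [ENNReal.add_thirds]

end Boundary

/-! ### Formal degree and density -/

section Density

variable {G : Type*}

theorem exists_finset_of_finite_inter {Λ E : Set G} (h : (Λ ∩ E).Finite) :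
    ∃ F : Finset Λ, (∀ l : Λ, l ∈ F ↔ (l : G) ∈ E) ∧ (Λ ∩ E).encard = F.card := by
  have hfin : (Subtype.val ⁻¹' E : Set Λ).Finite :=
    (h.preimage Subtype.val_injective.injOn).subset fun l hl => ⟨l.2, hl⟩
  refine ⟨hfin.toFinset, fun l => by simp, ?_⟩
  rw [← Set.encard_coe_eq_coe_finsetCard, hfin.coe_toFinset,
    ← Subtype.val_injective.encard_image, Subtype.image_preimage_coe]

theorem mul_card_le_enorm_sum_of_le_re {ι : Type*} {F : Finset ι} {w : ι → ℂ} {α : ℝ≥0}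
    (h : ∀ i ∈ F, (α : ℝ) ≤ (w i).re) : (α : ℝ≥0∞) * F.card ≤ ‖∑ i ∈ F, w i‖ₑ := by
  have hre : (α : ℝ) * F.card ≤ ‖∑ i ∈ F, w i‖ := by
    refine le_trans ?_ (Complex.re_le_norm _)
    rw [Complex.re_sum, mul_comm, ← nsmul_eq_mul]
    exact Finset.card_nsmul_le_sum _ _ _ h
  rw [enorm_eq_nnnorm]
  exact_mod_cast hre

namespace ProjUnitaryRep

variable [Group G] [MeasurableSpace G] {H : Type*} [NormedAddCommGroup H] [InnerProductSpace ℂ H]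
  {π : ProjUnitaryRep G H} {g : H} {Λ : Set G} {μ : Measure G} {d : ℝ}
  {S R : H →L[ℂ] H}

theorem IsFormalDegree.integral_sum (hd : π.IsFormalDegree μ d) (R : H →L[ℂ] H) (F : Finset Λ) :
    ∫ y, ∑ l ∈ F, inner ℂ (π y g) (R (π (l : G) g)) * inner ℂ (π (l : G) g) (π y g) ∂μ
      = ((d⁻¹ * ‖g‖ ^ 2 : ℝ) : ℂ) * ∑ l ∈ F, inner ℂ (π (l : G) g) (R (π (l : G) g)) := by
  rw [integral_finsetSum _ fun l _ => (hd.2 _ _ _ _).1, Finset.mul_sum]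
  refine Finset.sum_congr rfl fun l _ => ?_
  rw [(hd.2 _ _ _ _).2, inner_self_eq_norm_sq_to_K (𝕜 := ℂ) g, map_pow, RCLike.conj_ofReal]
  push_cast
  exact mul_right_comm _ _ _

variable [CompleteSpace H]

/-- The partial sum over `E` of the frame expansion of `⟨π y g, R S π y g⟩`. -/
theorem enorm_sum_inner_mul_inner_le (hS : IsFrameOperator (fun l : Λ => π (l : G) g) S)
    (hR : IsSelfAdjoint R) {E : Set G} {F : Finset Λ} (hF : ∀ l : Λ, l ∈ F ↔ (l : G) ∈ E) (y : G) :
    ‖∑ l ∈ F, inner ℂ (π y g) (R (π (l : G) g)) * inner ℂ (π (l : G) g) (π y g)‖ₑ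
      ≤ E.indicator (fun _ => ‖R * S‖ₑ * ‖g‖ₑ ^ 2) y
        + ‖R‖ₑ * ‖g‖ₑ ^ 2 * crossSum Λ E (fun y l => ‖π.coeff g g (y⁻¹ * l)‖ₑ) y := by
  have hbound : ∀ (T : H →L[ℂ] H) (a b : G),
      ‖inner ℂ (π a g) (T (π b g))‖ₑ ≤ ‖T‖ₑ * ‖g‖ₑ ^ 2 := fun T a b => by
    calc ‖inner ℂ (π a g) (T (π b g))‖ₑ ≤ ‖π a g‖ₑ * ‖T (π b g)‖ₑ := by
          simp only [enorm_eq_nnnorm]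
          exact_mod_cast nnnorm_inner_le_nnnorm _ _
      _ ≤ ‖π a g‖ₑ * (‖T‖ₑ * ‖π b g‖ₑ) := by gcongr; exact T.le_opENorm _
      _ = ‖T‖ₑ * ‖g‖ₑ ^ 2 := by
        rw [LinearIsometryEquiv.enorm_map, LinearIsometryEquiv.enorm_map]
        ring
  have hsum : HasSum
      (fun l : Λ => inner ℂ (π y g) (R (π (l : G) g)) * inner ℂ (π (l : G) g) (π y g))
      (inner ℂ (π y g) ((R * S) (π y g))) := by
    have hRsymm : ∀ a b : H, inner ℂ (R a) b = inner ℂ a (R b) :=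
      ContinuousLinearMap.isSelfAdjoint_iff_isSymmetric.1 hR
    simpa only [hRsymm, mul_apply_eq_comp] using hS (R (π y g)) (π y g)
  refine (enorm_sum_le_indicator_add_crossSum
    (w := fun l => inner ℂ (π y g) (R (π l g)) * inner ℂ (π l g) (π y g)) hsum hF y).trans
    (add_le_add ?_ ?_)
  · exact Set.indicator_le_indicator (hbound _ _ _)
  · refine crossSum_le_mul fun l _ => ?_
    rw [enorm_mul, ← absMatrix_one, absMatrix, one_apply_eq_self,
      ← ofReal_norm (inner ℂ (π l g) _), norm_inner_symm, ofReal_norm]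
    gcongr
    exact hbound R y l

/-- Integrate the frame expansion of `⟨π y g, R S π y g⟩` restricted to `E`. -/
theorem IsFormalDegree.enorm_sum_inner_le (hd : π.IsFormalDegree μ d)
    (hS : IsFrameOperator (fun l : Λ => π (l : G) g) S) (hR : IsSelfAdjoint R) {E : Set G}
    (hE : MeasurableSet E) {F : Finset Λ} (hF : ∀ l : Λ, l ∈ F ↔ (l : G) ∈ E) :
    ‖∑ l ∈ F, inner ℂ (π (l : G) g) (R (π (l : G) g))‖ₑ
      ≤ ENNReal.ofReal d * (‖R * S‖ₑ * μ E
        + ‖R‖ₑ * ∫⁻ y, crossSum Λ E (fun y l => ‖π.coeff g g (y⁻¹ * l)‖ₑ) y ∂μ) := by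
  rcases eq_or_ne g 0 with rfl | hg
  · simp
  have hg0 : ‖g‖ₑ ^ 2 ≠ 0 := by simpa using hg
  have hscale : ENNReal.ofReal d * ‖((d⁻¹ * ‖g‖ ^ 2 : ℝ) : ℂ)‖ₑ = ‖g‖ₑ ^ 2 := by
    have := hd.1
    rw [← ofReal_norm, ← ofReal_norm, Complex.norm_real, Real.norm_of_nonneg (by positivity),
      ← ENNReal.ofReal_mul hd.1.le, mul_inv_cancel_left₀ hd.1.ne',
      ENNReal.ofReal_pow (norm_nonneg g)]
  refine (ENNReal.mul_le_mul_iff_right hg0 (by finiteness)).1 ?_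
  calc ‖g‖ₑ ^ 2 * ‖∑ l ∈ F, inner ℂ (π (l : G) g) (R (π (l : G) g))‖ₑ
      = ENNReal.ofReal d * ‖∫ y, ∑ l ∈ F,
          inner ℂ (π y g) (R (π (l : G) g)) * inner ℂ (π (l : G) g) (π y g) ∂μ‖ₑ := by
        rw [hd.integral_sum, enorm_mul, ← mul_assoc, hscale]
    _ ≤ ENNReal.ofReal d * ∫⁻ y, (E.indicator (fun _ => ‖R * S‖ₑ * ‖g‖ₑ ^ 2) y
          + ‖R‖ₑ * ‖g‖ₑ ^ 2 * crossSum Λ E (fun y l => ‖π.coeff g g (y⁻¹ * l)‖ₑ) y) ∂μ := by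
        gcongr
        exact (enorm_integral_le_lintegral_enorm _).trans
          (lintegral_mono fun y => enorm_sum_inner_mul_inner_le hS hR hF y)
    _ = _ := by
        rw [lintegral_add_left (measurable_const.indicator hE), lintegral_indicator_const hE,
          lintegral_const_mul' _ _ (by finiteness)]
        ring

variable [TopologicalSpace G] [IsTopologicalGroup G] [T2Space G] [LocallyCompactSpace G]
  [SecondCountableTopology G] [BorelSpace G] [μ.IsHaarMeasure] [μ.IsInvInvariant] {Q : Set G}
  {N : ℕ} {K : ℕ → Set G}

/-- In a large translate `x • K n` the diagonal entries `⟨π l g, R π l g⟩` sum to about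
`d * μ (K n)`, while there are at least `r * μ (K n)` of them. -/
theorem IsFormalDegree.isRelativelyDense_setOf_re_inner_le (hd : π.IsFormalDegree μ d)
    (hg : g ∈ π.B1 μ Q) (hΛ : IsRelativelySeparated Q N Λ) (hQc : IsCompact Q) (hQs : Q⁻¹ = Q)
    (hQ1 : Q ∈ 𝓝 (1 : G)) (hS : IsFrameOperator (fun l : Λ => π (l : G) g) S)
    (hR : IsSelfAdjoint R) (hK : IsStrongFolnerSeq μ K) {α r : ℝ≥0}
    (hdens : ∀ᶠ n in atTop, (r : ℝ≥0∞) ≤ minRelativeCount μ Λ (K n))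
    (hdr : ENNReal.ofReal d * ‖R * S‖ₑ < α * r) :
    IsRelativelyDense {l ∈ Λ | (inner ℂ (π l g) (R (π l g))).re ≤ α} := by
  obtain ⟨c, hc0, hc⟩ := ENNReal.lt_iff_exists_add_pos_lt.1 hdr
  obtain ⟨ε, hε, hεc⟩ := exists_ne_zero_mul_le (d.toNNReal * ‖R‖₊)
    (ENNReal.coe_ne_zero.2 hc0.ne')
  have hcross := hK.eventually_lintegral_crossSum_le (φ := fun w => ‖π.coeff g g w‖ₑ) hΛ hQc hQs hQ1
    (π.stronglyMeasurable_coeff g g).enorm (lintegral_enorm_coeff_ne_top hg hQs hQ1)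
    (isLocalizedKernel_enorm_coeff hg hΛ hQc hQs hQ1) hε
  obtain ⟨n, hrn, hcrossn, hcardn⟩ := (hdens.and (hcross.and
    (hΛ.eventually_encard_inter_smul_le hQc hQs hQ1 hK.toIsFolnerSeq))).exists
  have hK0 := hK.measure_ne_zero n
  have hKt := (hK.isCompact n).measure_ne_top (μ := μ)
  refine ⟨K n, hK.isCompact n, fun x => ?_⟩
  by_contra hempty
  have hlarge : ∀ l ∈ Λ, l ∈ x • K n → (α : ℝ) ≤ (inner ℂ (π l g) (R (π l g))).re :=
    fun l hl hlK => le_of_not_ge fun hle => hempty ⟨l, ⟨hl, hle⟩, hlK⟩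
  have hfin : (Λ ∩ x • K n).Finite := by
    rw [← Set.encard_lt_top_iff, ← ENat.toENNReal_lt, ENat.toENNReal_top]
    have hQ0 : μ Q ≠ 0 := (Measure.measure_pos_of_mem_nhds μ hQ1).ne'
    exact (hcardn x).trans_lt (ENNReal.mul_lt_top
      (ENNReal.div_ne_top (by finiteness) hQ0).lt_top hKt.lt_top)
  obtain ⟨F, hF, hcardF⟩ := exists_finset_of_finite_inter hfin
  have hlower : α * r * μ (K n) ≤ ‖∑ l ∈ F, inner ℂ (π (l : G) g) (R (π (l : G) g))‖ₑ := by
    have hrF : r * μ (K n) ≤ F.card := by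
      rw [← ENNReal.le_div_iff_mul_le (.inl hK0) (.inl hKt)]
      simpa [hcardF] using hrn.trans (iInf_le _ x)
    calc α * r * μ (K n) ≤ α * F.card := by rw [mul_assoc]; gcongr
      _ ≤ _ := mul_card_le_enorm_sum_of_le_re fun l hl => hlarge l l.2 ((hF l).1 hl)
  have hupper : ‖∑ l ∈ F, inner ℂ (π (l : G) g) (R (π (l : G) g))‖ₑ
      ≤ (ENNReal.ofReal d * ‖R * S‖ₑ + c) * μ (K n) := by
    refine (hd.enorm_sum_inner_le hS hR
      ((hK.isCompact n).isClosed.measurableSet.const_smul x) hF).trans ?_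
    calc _ ≤ ENNReal.ofReal d * (‖R * S‖ₑ * μ (K n) + ‖R‖ₑ * (ε * μ (K n))) := by
          rw [measure_smul]
          gcongr
          exact hcrossn x
      _ = (ENNReal.ofReal d * ‖R * S‖ₑ + (d.toNNReal * ‖R‖₊ : ℝ≥0) * ε) * μ (K n) := by
          rw [ENNReal.coe_mul, ← enorm_eq_nnnorm, ENNReal.ofReal]
          ring
      _ ≤ _ := by gcongr
  exact ((hlower.trans hupper).trans_lt (ENNReal.mul_lt_mul_left hK0 hKt hc)).false

end ProjUnitaryRep

end Density

/-! ### Removing a sparse set -/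

theorem IsRelativelyDense.exists_pairwise_separated_subset {G : Type*} [Group G]
    [TopologicalSpace G] [IsTopologicalGroup G] {Λ C : Set G} (hΛ : IsRelativelyDense Λ)
    (hC : IsCompact C) :
    ∃ Γ ⊆ Λ, (Γ.Pairwise fun i j => j ∉ i • C) ∧ IsRelativelyDense Γ := by
  let r : Λ → Λ → Prop := fun i j => (j : G) ∉ (i : G) • C ∧ (i : G) ∉ (j : G) • C
  obtain ⟨J, hJ⟩ : ∃ J : Set Λ, IsMaxChain r J := ⟨_, maxChain_spec⟩
  have hsep : ∀ i ∈ J, ∀ j ∈ J, i ≠ j → r i j := fun i hi j hj hij =>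
    (hJ.1 hi hj hij).elim id And.symm
  have hmax : ∀ l : Λ, ∃ i ∈ J, (i : G) ∈ (l : G) • (C ∪ C⁻¹ ∪ {1}) := by
    intro l
    by_contra! hfar
    simp only [Set.smul_set_union, Set.mem_union, not_or, ← mem_smul_set_comm,
      Set.smul_set_singleton, smul_eq_mul, mul_one, Set.mem_singleton_iff] at hfar
    have hins : IsChain r (insert l J) :=
      hJ.1.insert fun i hi _ => .inl (hfar i hi).1
    exact (hfar l (hJ.2 hins (Set.subset_insert l J) ▸ Set.mem_insert l J)).2 rfl
  obtain ⟨L, hL, hmeet⟩ := hΛ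
  refine ⟨Subtype.val '' J, by simp, ?_, L * (C ∪ C⁻¹ ∪ {1}),
    hL.mul ((hC.union hC.inv).union isCompact_singleton), fun x => ?_⟩
  · rintro _ ⟨i, hi, rfl⟩ _ ⟨j, hj, rfl⟩ hij
    exact (hsep i hi j hj (ne_of_apply_ne _ hij)).1
  · obtain ⟨l, hl, hlL⟩ := hmeet x
    obtain ⟨i, hi, hil⟩ := hmax ⟨l, hl⟩
    refine ⟨i, ⟨i, hi, rfl⟩, ?_⟩
    rw [Set.mem_smul_set_iff_inv_smul_mem] at hlL hil ⊢
    simpa [mul_assoc] using Set.mul_mem_mul hlL hil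

theorem IsHilbertFrame.comp_equiv {ι κ H : Type*} [NormedAddCommGroup H] [InnerProductSpace ℂ H]
    {v : ι → H} (hv : IsHilbertFrame v) (e : κ ≃ ι) : IsHilbertFrame (v ∘ e) := by
  obtain ⟨A, B, hA, hB, h⟩ := hv
  refine ⟨A, B, hA, hB, fun f => ?_⟩
  have htsum := e.tsum_eq fun i => ‖inner ℂ (v i) f‖ ^ 2
  have hsum := (e.summable_iff (f := fun i => ‖inner ℂ (v i) f‖ ^ 2)).2 (h f).1
  exact ⟨hsum, (h f).2.1.trans_eq htsum.symm, htsum.trans_le (h f).2.2⟩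

theorem HasFrameBounds.exists_ne_zero {ι H : Type*} [NormedAddCommGroup H] [InnerProductSpace ℂ H]
    {v : ι → H} {A B : ℝ≥0} (hv : HasFrameBounds v A B) (hA : 0 < A) {f : H} (hf : f ≠ 0) :
    ∃ i, v i ≠ 0 := by
  by_contra! hzero
  have hlow := hv.lower f
  simp [hzero, hA.ne', hf] at hlow

theorem enorm_le_one_add_of_norm_one_sub_le {H : Type*} [NormedAddCommGroup H]
    [InnerProductSpace ℂ H] {T : H →L[ℂ] H} {δ : ℝ≥0} (h : ‖1 - T‖ ≤ δ) : ‖T‖ₑ ≤ 1 + δ := by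
  have hT : ‖T‖ ≤ 1 + δ :=
    (norm_le_norm_add_norm_sub' T 1).trans
      (add_le_add ContinuousLinearMap.norm_id_le ((norm_sub_rev _ _).trans_le h))
  rw [enorm_eq_nnnorm]
  exact_mod_cast hT

theorem exists_removal_parameters {d r : ℝ≥0} (h : d < r) (c : ℝ≥0) :
    ∃ α γ δ : ℝ≥0, α + γ = 1 ∧ 0 < γ ∧ 0 < δ ∧ d * (1 + δ) < α * r ∧
      6 * (δ ^ 2 + c * δ ^ 2) ≤ γ ^ 2 := by
  have hr : 0 < r := pos_of_gt h
  obtain ⟨α, hdα, hα1⟩ := exists_between ((div_lt_one hr).2 h)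
  have hγ : 0 < 1 - α := tsub_pos_of_lt hα1
  have hdens : ∀ᶠ δ : ℝ≥0 in 𝓝 0, d * (1 + δ) < α * r :=
    ContinuousAt.eventually_lt (by fun_prop) (by fun_prop) (by simpa using (div_lt_iff₀ hr).1 hdα)
  have hsmall : ∀ᶠ δ : ℝ≥0 in 𝓝 0, 6 * (δ ^ 2 + c * δ ^ 2) < (1 - α) ^ 2 :=
    ContinuousAt.eventually_lt (by fun_prop) (by fun_prop) (by simpa using pow_pos hγ 2)
  obtain ⟨δ, ⟨hδdens, hδsmall⟩, hδ⟩ :=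
    (((hdens.and hsmall).filter_mono nhdsWithin_le_nhds).and
      (self_mem_nhdsWithin (s := Set.Ioi 0))).exists
  exact ⟨α, 1 - α, δ, add_tsub_cancel_of_le hα1.le, hγ, hδ, hδdens, hδsmall.le⟩

theorem ProjUnitaryRep.exists_isCompact_isHilbertFrame_diff {G : Type*} [Group G]
    [TopologicalSpace G] [MeasurableSpace G] {H : Type*} [NormedAddCommGroup H]
    [InnerProductSpace ℂ H] [CompleteSpace H] {π : ProjUnitaryRep G H} {g : H} {Λ : Set G}
    {S R : H →L[ℂ] H} {A B γ ε δ : ℝ≥0} (hS : IsFrameOperator (fun l : Λ => π (l : G) g) S)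
    (hv : HasFrameBounds (fun l : Λ => π (l : G) g) A B) (hA : 0 < A) (hAB : A ≤ B)
    (hR : IsSelfAdjoint R) (hRloc : R ∈ π.localizedOps g Λ) (hγ : 0 < γ) (hε : 0 < ε)
    (hδ : ‖1 - R * S‖ ≤ δ) (hsmall : 6 * (ε ^ 2 + B / A * δ ^ 2) ≤ γ ^ 2) :
    ∃ C : Set G, IsCompact C ∧ ∀ Γ : Set G, (Γ.Pairwise fun i j => j ∉ i • C) →
      (∀ l ∈ Γ, (inner ℂ (π l g) (R (π l g))).re ≤ 1 - γ) →
      IsHilbertFrame (fun l : (Λ \ Γ : Set G) => π (l : G) g) := by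
  classical
  obtain ⟨M, hrow⟩ := hRloc.exists_row_bound
  obtain ⟨C, hC, htail⟩ := hRloc.exists_tail_bound ε (by exact_mod_cast hε.ne')
  refine ⟨C, hC, fun Γ hsep hdiag => ?_⟩
  let J : Set Λ := Subtype.val ⁻¹' Γ
  have hoff : ∀ i : J, ∑' j : J,
      (if j = i then 0 else ‖inner ℂ (π (i : Λ) g) (R (π (j : Λ) g))‖ₑ) ≤ ε := fun i =>
    calc _ ≤ ∑' j : J, ((i : G) • C)ᶜ.indicator (π.absMatrix g R (i : Λ)) (j : Λ) := by
          refine ENNReal.tsum_le_tsum fun j => ?_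
          split_ifs with hij
          · exact zero_le
          · have hne : ((i : Λ) : G) ≠ (j : Λ) := fun h => hij (Subtype.ext (Subtype.ext h.symm))
            rw [Set.indicator_of_mem (show _ ∈ _ from hsep i.2 j.2 hne), absMatrix]
      _ ≤ ∑' l : Λ, ((i : G) • C)ᶜ.indicator (π.absMatrix g R (i : Λ)) l :=
          ENNReal.tsum_comp_le_tsum_of_injective Subtype.val_injective _
      _ ≤ ε := htail i i.1.2
  have hframe := hS.isHilbertFrame_compl hv hA hAB hR hγ (J := J) (fun l hl => hdiag l hl) hoff
    (fun l => hrow l l.2) hδ hsmall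
  let e : (Λ \ Γ : Set G) ≃ ↥Jᶜ :=
    { toFun l := ⟨⟨l, l.2.1⟩, l.2.2⟩
      invFun l := ⟨l, l.1.2, l.2⟩ }
  exact hframe.comp_equiv e

theorem theorem1p1
    {G : Type*} [Group G] [TopologicalSpace G] [IsTopologicalGroup G] [T2Space G]
    [LocallyCompactSpace G] [SecondCountableTopology G] [MeasurableSpace G] [BorelSpace G]
    -- a Haar measure, right-invariant because `G` is unimodular
    (μ : Measure G) [μ.IsHaarMeasure] [μ.IsMulRightInvariant]
    (hG : IsAmenableGroup μ)
    -- the fixed compact symmetric unit neighbourhood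
    (Q : Set G) (hQc : IsCompact Q) (hQs : Q⁻¹ = Q) (hQ1 : Q ∈ 𝓝 (1 : G))
    {H : Type*} [NormedAddCommGroup H] [InnerProductSpace ℂ H] [CompleteSpace H]
    (π : ProjUnitaryRep G H) (hπ : π.IsIntegrableRep μ)
    (Λ : Set G) (hΛ : IsDiscrete Λ)
    (g : H) (hg : g ∈ π.B1 μ Q)
    (hframe : IsHilbertFrame (fun l : Λ => π (l : G) g))
    -- the density of `Λ`, computed along some strong Følner sequence, exceeds the formal degree
    (K : ℕ → Set G) (hK : IsStrongFolnerSeq μ K)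
    (hdens : ENNReal.ofReal (π.formalDegree μ) < lowerBeurlingDensity μ K Λ) :
    ∃ Γ : Set G, Γ ⊆ Λ ∧
      (∃ D : ℝ≥0∞, 0 < D ∧ HasLowerBeurlingDensity μ Γ D) ∧
      IsHilbertFrame (fun l : (Λ \ Γ : Set G) => π (l : G) g) := by
  have := isInvInvariant_of_isMulRightInvariant μ
  obtain ⟨A, B, hA, hAB, hv⟩ := isHilbertFrame_iff_exists_hasFrameBounds.1 hframe
  obtain ⟨S, hS⟩ := hv.exists_isFrameOperator
  obtain ⟨f, hf, -⟩ := hπ.exists_integrable_vector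
  obtain ⟨l, hl⟩ := hv.exists_ne_zero hA hf
  have hg0 : g ≠ 0 := (map_ne_zero_iff _ (π l).injective).1 hl
  obtain ⟨N, hN⟩ := π.exists_isRelativelySeparated hg0 ENNReal.coe_ne_top hv.upper hQc
  obtain ⟨r, hdr, hr⟩ := ENNReal.lt_iff_exists_nnreal_btwn.1 hdens
  obtain ⟨α, γ, δ, hαγ, hγ, hδ, hdα, hsmall⟩ :=
    exists_removal_parameters (ENNReal.coe_lt_coe.1 hdr) (B / A)
  have h1 : 1 ∈ π.localizedOps g Λ := ProjUnitaryRep.one_mem_localizedOps hg hN hQc hQs hQ1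
  obtain ⟨R, hRloc, hR, hRS⟩ := hS.exists_approx_inverse hv hA hAB (π.localizedOps g Λ) h1
    (fun X => ProjUnitaryRep.mul_mem_localizedOps h1 hS) (NNReal.coe_pos.2 hδ)
  have hdRS : ENNReal.ofReal (π.formalDegree μ) * ‖R * S‖ₑ < α * r :=
    (mul_le_mul_right (enorm_le_one_add_of_norm_one_sub_le hRS) _).trans_lt
      (ENNReal.coe_lt_coe.2 hdα)
  have hlow := hπ.isFormalDegree_formalDegree.isRelativelyDense_setOf_re_inner_le hg hN hQc hQs
    hQ1 hS hR hK ((eventually_lt_of_lt_liminf hr).mono fun n => le_of_lt) hdRS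
  obtain ⟨C, hC, hremove⟩ := ProjUnitaryRep.exists_isCompact_isHilbertFrame_diff hS hv hA hAB hR
    hRloc hγ hδ hRS hsmall
  obtain ⟨Γ, hΓ, hsep, hΓd⟩ := hlow.exists_pairwise_separated_subset hC
  have hΓΛ : Γ ⊆ Λ := fun l hl => (hΓ hl).1
  refine ⟨Γ, hΓΛ, hΓd.exists_pos_hasLowerBeurlingDensity (hN.mono hΓΛ) hQc hQs hQ1,
    hremove Γ hsep fun l hl => (hΓ hl).2.trans_eq ?_⟩
  exact eq_sub_of_add_eq (mod_cast hαγ)
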